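/- Let $G=(V,E)$ be a directed acyclic graph on $V=\{1,\dots,p\}$ and let $\breve x(k)\in\mathbb R^p$, $k\in\mathbb Z$, be the states of a linear dynamical system over $G$, $$\breve x_i(k)=\sum_{j}(\breve h_{ij}\star\breve x_j)(k)+\breve e_i(k),\qquad k\in\mathbb Z,\ 1\le i\le p,$$ where $\breve h_{ij}:\mathbb Z\to\mathbb R$ is a nonzero filter if $(j,i)\in E$ and $\breve h_{ij}=0$ otherwise, the two-sided convolution sums are limits in mean square of their symmetric partial sums, and the noise $\breve e=(\breve e_1,\dots,\breve e_p)$ is a zero-mean wide-sense stationary (jointly) Gaussian process whose coordinates are mutually uncorrelated (their power spectral densities need not be equal). Put $R_x(k)=\mathbb E[\breve x(k)\breve x(0)^T]$ and $\Phi_x(\omega)=\sum_{k\in\mathbb Z}R_x(k)e^{-i\omega k}$, and let $\|\cdot\|$ be the spectral norm. Assume: 1. $\frac1M\le\lambda_{\min}(\Phi_x(\omega))\le\lambda_{\max}(\Phi_x(\omega))\le M$ for all $\omega\in[0,2\pi]$, for a real $M>0$; 2. $\|R_x(k)\|\le C\rho^{-|k|}$ for all $k\in\mathbb Z$, for real constants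 $C>0$, $\rho>1$. Let $\{\breve x^r(k)\}_{k=0}^{N-1}$, $1\le r\le n$, be $n$ recorded trajectories of length $N$, obtained either by restart and record (independent trajectories, each with the law of $(\breve x(0),\dots,\breve x(N-1))$) or by continuous sampling (the $n$ consecutive segments of length $N$ of a single trajectory $\breve x(0),\dots,\breve x(nN-1)$). Put $${\bf x}^r(\omega)=\frac1{\sqrt N}\sum_{k=0}^{N-1}\breve x^r(k)e^{-i\omega k},\qquad \widehat\Phi_x(\omega)=\frac1n\sum_{r=1}^n{\bf x}^r(\omega)[{\bf x}^r(\omega)]^*.$$ Let $0<\varepsilon_1,\varepsilon_2<\varepsilon$ with $\varepsilon_2=\varepsilon-\varepsilon_1$ and $\varepsilon_2\le 12M$, and suppose that $N>\frac{2C\rho^{-1}}{(1-\rho^{-1})^2\varepsilon_1}$. Then for every $\omega\in[0,2\pi]$, $$\mathbb P\left(\|\Phi_x(\omega)-\widehat\Phi_x(\omega)\|\ge\varepsilon\right)\le\exp\left(-\frac{\varepsilon_2^2\,n}{128M^2}+6p\right).$$ -/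

import Mathlib

open MeasureTheory ProbabilityTheory Filter Topology
open scoped Matrix.Norms.L2Operator

namespace DDAG

variable {Ω Ω' : Type*} [MeasurableSpace Ω] [MeasurableSpace Ω'] {p n N : ℕ}

/-- A directed graph without directed cycles (in particular, without self-loops). -/
def IsAcyclic (G : Digraph (Fin p)) : Prop :=
  ∀ i, ¬ Relation.TransGen G.Adj i i

/-- The exogenous noise: a zero-mean, wide-sense stationary (vector-valued, i.e. jointly) Gaussian
process indexed by `ℤ`, whose coordinates are mutually uncorrelated. -/
structure IsExogenousNoise (P : Measure Ω) (e : ℤ → Ω → Fin p → ℝ) : Prop where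
  gaussian : IsGaussianProcess e P
  zero_mean : ∀ k i, ∫ ω, e k ω i ∂P = 0
  stationary : ∀ k l i j,
    ∫ ω, e (k + l) ω i * e l ω j ∂P = ∫ ω, e k ω i * e 0 ω j ∂P
  uncorrelated : ∀ i j, i ≠ j → ∀ k l, ∫ ω, e k ω i * e l ω j ∂P = 0

/-- The linear dynamical system over the directed acyclic graph `G`, with filters
`h i j : ℤ → ℝ` (nonzero exactly on the edges `j → i`), exogenous noise `e` and states `x`:
`x_i(k) = ∑_j (h_ij ⋆ x_j)(k) + e_i(k)` for all times `k : ℤ` and all nodes `i`.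
The two-sided convolution sum `∑_m h_ij(m) x_j(k - m)` is the limit in mean square of its partial
sums over `|m| ≤ K`. -/
structure IsLDS (P : Measure Ω) (G : Digraph (Fin p)) (h : Fin p → Fin p → ℤ → ℝ)
    (e x : ℤ → Ω → Fin p → ℝ) : Prop where
  acyclic : IsAcyclic G
  filter_ne_zero_iff : ∀ i j, h i j ≠ 0 ↔ G.Adj j i
  noise : IsExogenousNoise P e
  measurable_state : ∀ k, Measurable (x k)
  dynamics : ∀ k i, Tendsto
    (fun K : ℕ => eLpNorm
      (fun ω => x k ω i
        - (∑ j, ∑ m ∈ Finset.Icc (-(K : ℤ)) K, h i j m * x (k - m) ω j + e k ω i)) 2 P)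
    atTop (𝓝 0)

/-- The autocorrelation matrix `R_x(k) = E[x(k) x(0)ᵀ]`. -/
noncomputable def autocorr (P : Measure Ω) (x : ℤ → Ω → Fin p → ℝ) (k : ℤ) :
    Matrix (Fin p) (Fin p) ℝ :=
  Matrix.of fun i j => ∫ ω, x k ω i * x 0 ω j ∂P

/-- The power spectral density matrix `Φ_x(θ) = ∑_{k ∈ ℤ} R_x(k) e^{-iθk}`. -/
noncomputable def psdm (P : Measure Ω) (x : ℤ → Ω → Fin p → ℝ) (θ : ℝ) :
    Matrix (Fin p) (Fin p) ℂ :=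
  Matrix.of fun i j =>
    ∑' k : ℤ, (autocorr P x k i j : ℂ) * Complex.exp (-(Complex.I * θ * k))

/-- All eigenvalues of the (Hermitian) matrices `Φ_x(θ)`, `θ ∈ [0, 2π]`, lie in `[1/M, M]`. -/
def PSDMBound (P : Measure Ω) (x : ℤ → Ω → Fin p → ℝ) (M : ℝ) : Prop :=
  0 < M ∧ ∀ θ ∈ Set.Icc 0 (2 * Real.pi), ∀ μ ∈ spectrum ℝ (psdm P x θ), 1 / M ≤ μ ∧ μ ≤ M

/-- Geometric decay `‖R_x(k)‖ ≤ C ρ^{-|k|}` of the autocorrelation in spectral norm. -/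
def AutocorrDecay (P : Measure Ω) (x : ℤ → Ω → Fin p → ℝ) (C ρ : ℝ) : Prop :=
  0 < C ∧ 1 < ρ ∧ ∀ k : ℤ, ‖autocorr P x k‖ ≤ C * ρ ^ (-|k|)

/-- Restart and record: the `n` trajectories `y 0, …, y (n-1)` are independent, and each has the
law of `N` consecutive states `x(0), …, x(N-1)` of the system. -/
structure RestartAndRecord (P : Measure Ω) (x : ℤ → Ω → Fin p → ℝ)
    (P' : Measure Ω') (y : Fin n → Ω' → Fin N → Fin p → ℝ) : Prop where
  indep : iIndepFun y P'
  law : ∀ r, IdentDistrib (y r) (fun ω (t : Fin N) => x (t : ℤ) ω) P' P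

/-- Continuous sampling: the `n` trajectories are the consecutive segments of length `N` of one
trajectory `x(0), …, x(nN-1)` of the system (i.e. they have the joint law of these segments). -/
def ContinuousSampling (P : Measure Ω) (x : ℤ → Ω → Fin p → ℝ)
    (P' : Measure Ω') (y : Fin n → Ω' → Fin N → Fin p → ℝ) : Prop :=
  IdentDistrib (fun ω' (r : Fin n) => y r ω')
    (fun ω (r : Fin n) (t : Fin N) => x ((r : ℤ) * N + t) ω) P' P

/-- The normalized finite Fourier transform `N^{-1/2} ∑_{k=0}^{N-1} y(k) e^{-iθk}` of a recorded
trajectory. -/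
noncomputable def dft (y : Fin N → Fin p → ℝ) (θ : ℝ) : Fin p → ℂ :=
  fun i => (1 / (Real.sqrt N : ℂ)) *
    ∑ k : Fin N, (y k i : ℂ) * Complex.exp (-(Complex.I * θ * ((k : ℕ) : ℂ)))

/-- The spectrogram estimator `(1/n) ∑_r x^r(θ) [x^r(θ)]^*` built from `n` trajectories. -/
noncomputable def psdmEstimator (y : Fin n → Fin N → Fin p → ℝ) (θ : ℝ) :
    Matrix (Fin p) (Fin p) ℂ :=
  (1 / (n : ℂ)) • ∑ r, Matrix.vecMulVec (dft (y r) θ) (star (dft (y r) θ))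

end DDAG

/-!
The states of the system are mean-square limits of linear combinations of time shifts of the noise,
so by induction along the graph they form a centred stationary Gaussian process themselves.

By the triangle inequality it suffices to bound the bias and the fluctuation of the estimator `Ψ`.
Its mean is the `N`-th Fejér mean of the Fourier series `Φ_x`, and geometric decay of the
coefficients puts a Fejér mean within `O(1 / N)` of its limit. For a unit vector `v`, the number
`v^* Ψ v` is `1 / n` times the squared norm of a Gaussian vector in `ℂⁿ`. The covariance of the
samples is a block Toeplitz form, hence an average of values of the quadratic form of `Φ_x`, and so
bounded by `M`. Diagonalizing the covariance of the Gaussian vector leaves a sum of independent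
squares, which a Chernoff bound controls. As the fluctuation is a Hermitian matrix, half of its norm
is attained on any `1 / 2`-net of the unit sphere of `ℂᵖ`, and such a net exists with at most
`25 ^ p` points.
-/

namespace DDAG

section Concentration

variable {Ω ι : Type*} [MeasurableSpace Ω] {P : Measure Ω}

lemma inv_one_sub_le_exp {w : ℝ} (hw : |w| ≤ 1 / 2) : (1 - w)⁻¹ ≤ Real.exp (w + 2 * w ^ 2) := by
  have hw1 : w ≤ 1 / 2 := (le_abs_self w).trans hw
  have hlog := Real.abs_log_sub_add_sum_range_le (x := w) (by linarith) 1
  have hfrac : |w| ^ (1 + 1) / (1 - |w|) ≤ 2 * w ^ 2 := by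
    rw [div_le_iff₀ (by linarith), one_add_one_eq_two, sq_abs]
    nlinarith [sq_nonneg w]
  simp only [Finset.sum_range_one, zero_add, pow_one, Nat.cast_zero, div_one] at hlog
  rw [← Real.log_le_iff_le_exp (by simp; linarith), Real.log_inv]
  linarith [(abs_le.1 hlog).1]

lemma gaussianPDFReal_mul_exp_mul_sq {v : NNReal} (hv : v ≠ 0) (s x : ℝ) :
    gaussianPDFReal 0 v x * Real.exp (s * x ^ 2)
      = (√(2 * Real.pi * v))⁻¹ * Real.exp (-((1 - 2 * s * v) / (2 * v)) * x ^ 2) := by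
  rw [gaussianPDFReal, mul_assoc, ← Real.exp_add]
  congr 2
  field_simp
  ring

lemma integrable_exp_mul_sq_gaussianReal {v : NNReal} {s : ℝ} (hs : 2 * s * v < 1) :
    Integrable (fun x => Real.exp (s * x ^ 2)) (gaussianReal 0 v) := by
  rcases eq_or_ne v 0 with rfl | hv
  · simp [gaussianReal_zero_var, integrable_dirac]
  have hb : 0 < (1 - 2 * s * v) / (2 * v) := div_pos (by linarith) (by positivity)
  rw [gaussianReal_of_var_ne_zero _ hv, integrable_withDensity_iff_integrable_smul' (by fun_prop)
    (ae_of_all _ fun x => by simp [gaussianPDF])]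
  simp only [toReal_gaussianPDF, smul_eq_mul, gaussianPDFReal_mul_exp_mul_sq hv]
  exact (integrable_exp_neg_mul_sq hb).const_mul _

lemma mgf_sq_gaussianReal {v : NNReal} {s : ℝ} (hs : 2 * s * v < 1) :
    mgf (fun x => x ^ 2) (gaussianReal 0 v) s = √((1 - 2 * s * v)⁻¹) := by
  rcases eq_or_ne v 0 with rfl | hv
  · simp [mgf, gaussianReal_zero_var]
  have : 1 - 2 * s * v ≠ 0 := by linarith
  simp only [mgf, integral_gaussianReal_eq_integral_smul hv, smul_eq_mul,
    gaussianPDFReal_mul_exp_mul_sq hv, integral_const_mul, integral_gaussian]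
  rw [← Real.sqrt_inv, ← Real.sqrt_mul (by positivity)]
  congr 1
  field_simp

lemma map_eq_gaussianReal_zero_variance {X : Ω → ℝ} (hX : HasGaussianLaw X P)
    (h0 : P[X] = 0) : P.map X = gaussianReal 0 Var[X; P].toNNReal := by
  rw [hX.map_eq_gaussianReal, h0]

lemma integrable_exp_mul_sq {X : Ω → ℝ} (hX : HasGaussianLaw X P) (h0 : P[X] = 0) {s : ℝ}
    (hs : 2 * s * Var[X; P] < 1) : Integrable (fun ω => Real.exp (s * X ω ^ 2)) P := by
  have := integrable_exp_mul_sq_gaussianReal (v := Var[X; P].toNNReal) (s := s)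
    (by rwa [Real.coe_toNNReal _ (variance_nonneg X P)])
  rw [← map_eq_gaussianReal_zero_variance hX h0] at this
  exact (integrable_map_measure (by fun_prop) hX.aemeasurable).1 this

lemma mgf_sq_le_exp {X : Ω → ℝ} (hX : HasGaussianLaw X P) (h0 : P[X] = 0) {s : ℝ}
    (hs : |s| * Var[X; P] ≤ 1 / 4) :
    mgf (fun ω => X ω ^ 2) P s ≤ Real.exp (s * Var[X; P] + 4 * s ^ 2 * Var[X; P] ^ 2) := by
  have hv := Real.coe_toNNReal _ (variance_nonneg X P)
  have hw : |2 * s * Var[X; P]| ≤ 1 / 2 := by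
    rw [abs_mul, abs_mul, abs_two, abs_of_nonneg (variance_nonneg X P)]
    linarith
  calc mgf (fun ω => X ω ^ 2) P s
      = mgf (fun x => x ^ 2) (gaussianReal 0 Var[X; P].toNNReal) s := by
        rw [← map_eq_gaussianReal_zero_variance hX h0, mgf_map hX.aemeasurable (by fun_prop)]
        rfl
    _ = √((1 - 2 * s * Var[X; P])⁻¹) := by
        rw [mgf_sq_gaussianReal (by rw [hv]; linarith [(abs_le.1 hw).2]), hv]
    _ ≤ √(Real.exp (2 * s * Var[X; P] + 2 * (2 * s * Var[X; P]) ^ 2)) :=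
        Real.sqrt_le_sqrt (inv_one_sub_le_exp hw)
    _ = Real.exp (s * Var[X; P] + 4 * s ^ 2 * Var[X; P] ^ 2) := by
        rw [Real.sqrt_eq_iff_mul_self_eq (by positivity) (by positivity), ← Real.exp_add]
        ring_nf

lemma measureReal_abs_sub_ge_le_of_mgf_le [IsFiniteMeasure P] {X : Ω → ℝ} {m c s : ℝ}
    (t : ℝ) (hs : 0 ≤ s)
    (hint : ∀ r, |r| = s → Integrable (fun ω => Real.exp (r * X ω)) P)
    (hmgf : ∀ r, |r| = s → mgf X P r ≤ Real.exp (r * m + c)) :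
    P.real {ω | t ≤ |X ω - m|} ≤ 2 * Real.exp (c - s * t) := by
  have hneg : |-s| = s := by rw [abs_neg, abs_of_nonneg hs]
  have hup : P.real {ω | m + t ≤ X ω} ≤ Real.exp (c - s * t) := by
    refine (measure_ge_le_exp_mul_mgf _ hs (hint s (abs_of_nonneg hs))).trans ?_
    refine (mul_le_mul_of_nonneg_left (hmgf s (abs_of_nonneg hs)) (Real.exp_pos _).le).trans_eq ?_
    rw [← Real.exp_add]
    ring_nf
  have hlo : P.real {ω | X ω ≤ m - t} ≤ Real.exp (c - s * t) := by
    refine (measure_le_le_exp_mul_mgf _ (neg_nonpos.2 hs) (hint (-s) hneg)).trans ?_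
    refine (mul_le_mul_of_nonneg_left (hmgf (-s) hneg) (Real.exp_pos _).le).trans_eq ?_
    rw [← Real.exp_add]
    ring_nf
  have hsub : {ω | t ≤ |X ω - m|} ⊆ {ω | m + t ≤ X ω} ∪ {ω | X ω ≤ m - t} := fun ω hω => by
    rcases le_abs.1 (Set.mem_ofPred.1 hω) with h | h
    · exact Or.inl (by simp only [Set.mem_ofPred_eq]; linarith)
    · exact Or.inr (by simp only [Set.mem_ofPred_eq]; linarith)
  linarith [(measureReal_mono (μ := P) hsub).trans (measureReal_union_le _ _)]

variable [Fintype ι]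

lemma integrable_exp_mul_sum_sq_of_iIndepFun {X : ι → Ω → ℝ}
    (hX : ∀ i, HasGaussianLaw (X i) P) (hind : iIndepFun X P) (h0 : ∀ i, P[X i] = 0) {s : ℝ}
    (hs : ∀ i, 2 * s * Var[X i; P] < 1) :
    Integrable (fun ω => Real.exp (s * ∑ i, X i ω ^ 2)) P := by
  have hind' : iIndepFun (fun i ω => X i ω ^ 2) P :=
    hind.comp (fun _ x => x ^ 2) fun _ => by fun_prop
  have hprod : mgf (∑ i, fun ω => X i ω ^ 2) P s = ∏ i, mgf (fun ω => X i ω ^ 2) P s :=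
    hind'.mgf_sum₀ (fun i => (hX i).aemeasurable.pow_const 2) Finset.univ
  have := hind.isProbabilityMeasure
  have hpos : 0 < mgf (∑ i, fun ω => X i ω ^ 2) P s :=
    hprod ▸ Finset.prod_pos fun i _ => mgf_pos (integrable_exp_mul_sq (hX i) (h0 i) (hs i))
  have hint := not_imp_comm.1 mgf_undef hpos.ne'
  simpa only [Finset.sum_apply] using hint

lemma mgf_sum_sq_le_of_iIndepFun {X : ι → Ω → ℝ}
    (hX : ∀ i, HasGaussianLaw (X i) P) (hind : iIndepFun X P) (h0 : ∀ i, P[X i] = 0) {s : ℝ}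
    (hs : ∀ i, |s| * Var[X i; P] ≤ 1 / 4) :
    mgf (fun ω => ∑ i, X i ω ^ 2) P s
      ≤ Real.exp (s * ∑ i, Var[X i; P] + 4 * s ^ 2 * ∑ i, Var[X i; P] ^ 2) := by
  have hind' : iIndepFun (fun i ω => X i ω ^ 2) P :=
    hind.comp (fun _ x => x ^ 2) fun _ => by fun_prop
  have hfun : (fun ω => ∑ i, X i ω ^ 2) = ∑ i, fun ω => X i ω ^ 2 := by
    ext ω
    simp only [Finset.sum_apply]
  rw [hfun, hind'.mgf_sum₀ fun i => (hX i).aemeasurable.pow_const 2, Finset.mul_sum,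
    Finset.mul_sum, ← Finset.sum_add_distrib, Real.exp_sum]
  exact Finset.prod_le_prod (fun i _ => mgf_nonneg) fun i _ => mgf_sq_le_exp (hX i) (h0 i) (hs i)

lemma measureReal_abs_sum_sq_sub_ge_le_of_iIndepFun {X : ι → Ω → ℝ}
    (hX : ∀ i, HasGaussianLaw (X i) P) (hind : iIndepFun X P) (h0 : ∀ i, P[X i] = 0)
    {M K t : ℝ} (hM : 0 < M) (hK : 0 < K) (hV : ∀ i, Var[X i; P] ≤ M)
    (hT : ∑ i, Var[X i; P] ≤ K * M) (ht : 0 ≤ t) (htM : t ≤ 6 * K * M) :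
    P.real {ω | t ≤ |∑ i, X i ω ^ 2 - ∑ i, Var[X i; P]|}
      ≤ 2 * Real.exp (-(t ^ 2 / (32 * K * M ^ 2))) := by
  have := hind.isProbabilityMeasure
  -- `s * t - 4 * s² * K * M²` is largest at `t / (8 * K * M²)`, but `s * M ≤ 1 / 4` is needed.
  set s : ℝ := t / (24 * K * M ^ 2) with hs
  have hs0 : 0 ≤ s := by positivity
  have hsM : s * M ≤ 1 / 4 := by
    rw [hs, div_mul_eq_mul_div, div_le_iff₀ (by positivity)]
    nlinarith
  have hsV : ∀ r, |r| = s → ∀ i, |r| * Var[X i; P] ≤ 1 / 4 := fun r hr i =>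
    hr ▸ (mul_le_mul_of_nonneg_left (hV i) hs0).trans hsM
  have hsq : ∑ i, Var[X i; P] ^ 2 ≤ K * M ^ 2 := calc
    ∑ i, Var[X i; P] ^ 2 ≤ ∑ i, M * Var[X i; P] := Finset.sum_le_sum fun i _ => by
        rw [sq]
        exact mul_le_mul_of_nonneg_right (hV i) (variance_nonneg _ _)
    _ = M * ∑ i, Var[X i; P] := (Finset.mul_sum _ _ _).symm
    _ ≤ M * (K * M) := mul_le_mul_of_nonneg_left hT hM.le
    _ = K * M ^ 2 := by ring
  refine (measureReal_abs_sub_ge_le_of_mgf_le (c := 4 * s ^ 2 * (K * M ^ 2)) t hs0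
    (fun r hr => integrable_exp_mul_sum_sq_of_iIndepFun hX hind h0 fun i => ?_)
    fun r hr => (mgf_sum_sq_le_of_iIndepFun hX hind h0 (hsV r hr)).trans ?_).trans ?_
  · nlinarith [hsV r hr i, le_abs_self r, variance_nonneg (X i) P]
  · rw [← sq_abs r, hr]
    gcongr
  · have hexp : 4 * s ^ 2 * (K * M ^ 2) - s * t = -(5 / 144 * (t ^ 2 / (K * M ^ 2))) := by
      rw [hs]
      field_simp
      ring
    have hcmp : t ^ 2 / (32 * K * M ^ 2) = 1 / 32 * (t ^ 2 / (K * M ^ 2)) := by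
      field_simp
    have hpos : 0 ≤ t ^ 2 / (K * M ^ 2) := by positivity
    rw [hexp, hcmp]
    gcongr 2 * Real.exp ?_
    linarith

end Concentration

section GaussianVector

open scoped RealInnerProductSpace

variable {Ω E : Type*} [MeasurableSpace Ω] {P : Measure Ω} [NormedAddCommGroup E]
  [InnerProductSpace ℝ E] [FiniteDimensional ℝ E] [MeasurableSpace E] [BorelSpace E] {Z : Ω → E}

lemma exists_orthonormalBasis_iIndepFun_inner (hZ : HasGaussianLaw Z P) (h0 : P[Z] = 0) :
    ∃ b : OrthonormalBasis (Fin (Module.finrank ℝ E)) ℝ E,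
      iIndepFun (fun i ω => ⟪b i, Z ω⟫) P := by
  have := hZ.isProbabilityMeasure
  have hL2 : MemLp id 2 (P.map Z) :=
    (memLp_map_measure_iff aestronglyMeasurable_id hZ.aemeasurable).2 hZ.memLp_two
  have hS := (isPositive_covarianceOperator (μ := P.map Z)).isSymmetric
  set b := hS.eigenvectorBasis rfl
  have hmean : ∀ i, P[fun ω => ⟪b i, Z ω⟫] = 0 := fun i => by
    rw [integral_inner hZ.integrable, h0, inner_zero_right]
  have hL2b : ∀ i, MemLp (fun ω => ⟪b i, Z ω⟫) 2 P := fun i => hZ.memLp_two.const_inner _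
  refine ⟨b, ?_⟩
  refine HasGaussianLaw.iIndepFun_of_covariance_eq_zero
    (hZ.map_fun (ContinuousLinearMap.pi fun i => innerSL ℝ (b i))) fun i j hij => ?_
  calc cov[fun ω => ⟪b i, Z ω⟫, fun ω => ⟪b j, Z ω⟫; P]
      = ∫ ω, ⟪b i, Z ω⟫ * ⟪b j, Z ω⟫ ∂P := by
        rw [covariance_eq_sub (hL2b i) (hL2b j), hmean i, zero_mul, sub_zero]
        rfl
    _ = ⟪covarianceOperator (P.map Z) (b i), b j⟫ := by
        rw [covarianceOperator_inner hL2, integral_map hZ.aemeasurable (by fun_prop)]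
    _ = hS.eigenvalues rfl i * ⟪b i, b j⟫ := by
        rw [← ContinuousLinearMap.coe_coe, hS.apply_eigenvectorBasis rfl i]
        exact real_inner_smul_left _ _ _
    _ = 0 := by rw [b.orthonormal.2 hij, mul_zero]

lemma measureReal_abs_norm_sq_sub_ge_le (hZ : HasGaussianLaw Z P) (h0 : P[Z] = 0)
    {M K t : ℝ} (hM : 0 < M) (hK : 0 < K) (hV : ∀ v, Var[fun ω => ⟪v, Z ω⟫; P] ≤ M * ‖v‖ ^ 2)
    (hT : ∫ ω, ‖Z ω‖ ^ 2 ∂P ≤ K * M) (ht : 0 ≤ t) (htM : t ≤ 6 * K * M) :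
    P.real {ω | t ≤ |‖Z ω‖ ^ 2 - ∫ ω, ‖Z ω‖ ^ 2 ∂P|}
      ≤ 2 * Real.exp (-(t ^ 2 / (32 * K * M ^ 2))) := by
  obtain ⟨b, hind⟩ := exists_orthonormalBasis_iIndepFun_inner hZ h0
  have hb : ∀ i, HasGaussianLaw (fun ω => ⟪b i, Z ω⟫) P := fun i =>
    hZ.map_fun (innerSL ℝ (b i))
  have hmean : ∀ i, P[fun ω => ⟪b i, Z ω⟫] = 0 := fun i => by
    rw [integral_inner hZ.integrable, h0, inner_zero_right]
  have hnorm : ∀ ω, ‖Z ω‖ ^ 2 = ∑ i, ⟪b i, Z ω⟫ ^ 2 := fun ω => (b.sum_sq_inner_right _).symm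
  have htrace : ∫ ω, ‖Z ω‖ ^ 2 ∂P = ∑ i, Var[fun ω => ⟪b i, Z ω⟫; P] := by
    simp_rw [hnorm]
    rw [integral_finsetSum _ fun i _ => (hb i).memLp_two.integrable_sq]
    exact Finset.sum_congr rfl fun i _ =>
      (variance_of_integral_eq_zero (hb i).aemeasurable (hmean i)).symm
  rw [htrace] at hT ⊢
  simp only [hnorm]
  refine measureReal_abs_sum_sq_sub_ge_le_of_iIndepFun hb hind hmean hM hK (fun i => ?_) hT ht htM
  simpa using hV (b i)

end GaussianVector

section SphereNet

open scoped NNReal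

variable {E : Type*} [NormedAddCommGroup E] [NormedSpace ℝ E] [FiniteDimensional ℝ E]

lemma card_le_of_isSeparated_sphere {s : Finset E} (hs : (s : Set E) ⊆ Metric.sphere 0 1)
    (hsep : Metric.IsSeparated (1 / 2 : ℝ≥0) (s : Set E)) :
    s.card ≤ 5 ^ Module.finrank ℝ E := by
  classical
  have hinj : Function.Injective fun v : E => (2 : ℝ) • v := smul_right_injective _ two_ne_zero
  rw [← Finset.card_image_of_injective s hinj]
  refine Besicovitch.card_le_of_separated _ (fun c hc => ?_) fun c hc d hd hcd => ?_
  · obtain ⟨v, hv, rfl⟩ := Finset.mem_image.1 hc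
    rw [norm_smul, mem_sphere_zero_iff_norm.1 (hs hv), Real.norm_two, mul_one]
  · obtain ⟨v, hv, rfl⟩ := Finset.mem_image.1 hc
    obtain ⟨w, hw, rfl⟩ := Finset.mem_image.1 hd
    have hvw : ((1 / 2 : ℝ≥0) : ENNReal) < edist v w := hsep hv hw fun h => hcd (by rw [h])
    rw [edist_nndist, ENNReal.coe_lt_coe, ← NNReal.coe_lt_coe, coe_nndist, dist_eq_norm] at hvw
    push_cast at hvw
    rw [← smul_sub, norm_smul, Real.norm_two]
    linarith

lemma packingNumber_sphere_le :
    Metric.packingNumber (1 / 2) (Metric.sphere (0 : E) 1) ≤ (5 ^ Module.finrank ℝ E : ℕ) := by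
  refine iSup_le fun C => iSup_le fun hC => iSup_le fun hsep => ?_
  by_contra! hlt
  obtain ⟨D, hDC, hD⟩ := Set.exists_subset_encard_eq (Order.add_one_le_of_lt hlt)
  have hfin : D.Finite := Set.finite_of_encard_eq_coe (k := 5 ^ Module.finrank ℝ E + 1) (by
    rw [hD]
    rfl)
  lift D to Finset E using hfin
  have hcard := card_le_of_isSeparated_sphere (hDC.trans hC) (hsep.subset hDC)
  rw [Set.encard_coe_eq_coe_finsetCard] at hD
  norm_cast at hD
  omega

variable (E) in
lemma exists_finset_isCover_sphere :
    ∃ s : Finset E, s.card ≤ 5 ^ Module.finrank ℝ E ∧ (s : Set E) ⊆ Metric.sphere 0 1 ∧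
      Metric.IsCover (1 / 2) (Metric.sphere 0 1) (s : Set E) := by
  have hle := (Metric.coveringNumber_le_packingNumber (1 / 2) (Metric.sphere (0 : E) 1)).trans
    packingNumber_sphere_le
  obtain ⟨C, hCs, hfin, hcover, hcard⟩ :=
    Metric.exists_set_encard_eq_coveringNumber (ne_top_of_le_ne_top (ENat.natCast_ne_top _) hle)
  lift C to Finset E using hfin
  rw [← hcard, Set.encard_coe_eq_coe_finsetCard] at hle
  exact ⟨C, by exact_mod_cast hle, hCs, hcover⟩

end SphereNet

section QuadraticForm

open scoped InnerProductSpace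

variable {𝕜 E : Type*} [RCLike 𝕜] [NormedAddCommGroup E] [InnerProductSpace 𝕜 E]

lemma inner_sub_apply_sub_of_apply_eq_zero {S : E →ₗ[𝕜] E} (hS : S.IsSymmetric) {u : E}
    (hu : S u = 0) (v : E) : ⟪v - u, S (v - u)⟫_𝕜 = ⟪v, S v⟫_𝕜 := by
  rw [map_sub, hu, sub_zero, inner_sub_left, ← hS u v, hu, inner_zero_left, sub_zero]

-- The quadratic form of `T - l` kills `u` to second order, so the loss is quadratic in `‖v - u‖`
-- and a net of radius `1 / 2` is fine enough.
lemma norm_mul_one_sub_le_norm_inner {T : E →L[𝕜] E} (hT : T.toLinearMap.IsSymmetric) {l : ℝ}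
    {u v : E} (hu : T u = (l : 𝕜) • u) (hl : |l| = ‖T‖) (hv : ‖v‖ = 1) :
    ‖T‖ * (1 - 2 * ‖v - u‖ ^ 2) ≤ ‖⟪v, T v⟫_𝕜‖ := by
  set S : E →L[𝕜] E := T - (l : 𝕜) • ContinuousLinearMap.id 𝕜 E with hS
  have hSsymm : S.toLinearMap.IsSymmetric := fun x y => by
    simpa [hS, inner_sub_left, inner_sub_right, inner_smul_left, inner_smul_right] using hT x y
  have hSu : S u = 0 := by simp [hS, hu]
  have hSnorm : ‖S‖ ≤ 2 * ‖T‖ := calc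
    ‖S‖ ≤ ‖T‖ + ‖(l : 𝕜) • ContinuousLinearMap.id 𝕜 E‖ := norm_sub_le _ _
    _ ≤ ‖T‖ + |l| * 1 := by
        rw [norm_smul, RCLike.norm_ofReal]
        gcongr
        exact ContinuousLinearMap.norm_id_le
    _ = 2 * ‖T‖ := by rw [hl]; ring
  have hquad : ⟪v, S v⟫_𝕜 = ⟪v, T v⟫_𝕜 - l := by
    simp [hS, inner_sub_right, inner_smul_right, inner_self_eq_norm_sq_to_K, hv]
  have hsmall : ‖⟪v, T v⟫_𝕜 - l‖ ≤ 2 * ‖T‖ * ‖v - u‖ ^ 2 := calc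
    ‖⟪v, T v⟫_𝕜 - l‖ = ‖⟪v - u, S (v - u)⟫_𝕜‖ := by
        rw [← hquad]
        exact congrArg _ (inner_sub_apply_sub_of_apply_eq_zero hSsymm hSu v).symm
    _ ≤ ‖v - u‖ * ‖S (v - u)‖ := norm_inner_le_norm _ _
    _ ≤ ‖v - u‖ * (2 * ‖T‖ * ‖v - u‖) := by
        gcongr
        exact S.le_of_opNorm_le hSnorm _
    _ = 2 * ‖T‖ * ‖v - u‖ ^ 2 := by ring
  have habs : ‖(l : 𝕜)‖ = ‖T‖ := by rw [RCLike.norm_ofReal, hl]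
  linarith [norm_sub_norm_le (l : 𝕜) ⟪v, T v⟫_𝕜, norm_sub_rev (l : 𝕜) ⟪v, T v⟫_𝕜]

variable {ι : Type*} [Fintype ι] [DecidableEq ι]

lemma inner_toEuclideanCLM_self (A : Matrix ι ι 𝕜) (v : EuclideanSpace 𝕜 ι) :
    ⟪v, Matrix.toEuclideanCLM (n := ι) (𝕜 := 𝕜) A v⟫_𝕜 = star v.ofLp ⬝ᵥ A.mulVec v.ofLp := by
  rw [EuclideanSpace.inner_eq_star_dotProduct, Matrix.ofLp_toEuclideanCLM, dotProduct_comm]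

lemma exists_abs_eigenvalues_eq_norm [Nonempty ι] {A : Matrix ι ι ℂ} (hA : A.IsHermitian) :
    ∃ i, |hA.eigenvalues i| = ‖A‖ := by
  have h := CStarAlgebra.norm_or_neg_norm_mem_spectrum (a := A) hA.isSelfAdjoint
  rw [hA.spectrum_real_eq_range_eigenvalues] at h
  rcases h with ⟨i, hi⟩ | ⟨i, hi⟩
  · exact ⟨i, by rw [hi, abs_norm]⟩
  · exact ⟨i, by rw [hi, abs_neg, abs_norm]⟩

lemma exists_norm_le_two_mul_norm_star_dotProduct [Nonempty ι] {A : Matrix ι ι ℂ}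
    (hA : A.IsHermitian) {s : Set (EuclideanSpace ℂ ι)} (hs : s ⊆ Metric.sphere 0 1)
    (hcover : Metric.IsCover (1 / 2) (Metric.sphere 0 1) s) :
    ∃ v ∈ s, ‖A‖ ≤ 2 * ‖star v.ofLp ⬝ᵥ A.mulVec v.ofLp‖ := by
  obtain ⟨i, hi⟩ := exists_abs_eigenvalues_eq_norm hA
  set u := hA.eigenvectorBasis i
  have hTu : Matrix.toEuclideanCLM (n := ι) (𝕜 := ℂ) A u = (hA.eigenvalues i : ℂ) • u := by
    ext j
    rw [Matrix.ofLp_toEuclideanCLM, hA.mulVec_eigenvectorBasis i]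
    simp [u]
  have hsymm : (Matrix.toEuclideanCLM (n := ι) (𝕜 := ℂ) A).toLinearMap.IsSymmetric :=
    Matrix.isSymmetric_toEuclideanLin_iff.2 hA
  obtain ⟨v, hv, huv⟩ := hcover (mem_sphere_zero_iff_norm.2 (hA.eigenvectorBasis.orthonormal.1 i))
  have hclose : ‖v - u‖ ≤ 1 / 2 := by
    rw [← dist_eq_norm, dist_comm, dist_edist]
    simpa using ENNReal.toReal_mono ENNReal.coe_ne_top huv
  have hkey := norm_mul_one_sub_le_norm_inner hsymm hTu hi (mem_sphere_zero_iff_norm.1 (hs hv))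
  rw [inner_toEuclideanCLM_self, ← Matrix.cstar_norm_def] at hkey
  refine ⟨v, hv, ?_⟩
  have hsq : ‖v - u‖ ^ 2 ≤ (1 / 2) ^ 2 := by gcongr
  nlinarith [norm_nonneg A]

end QuadraticForm

section BilateralSeries

variable {E : Type*} [NormedAddCommGroup E] {F : ℤ → E} {C q : ℝ}

lemma hasSum_const_mul_pow_add (C : ℝ) (hq₀ : 0 < q) (hq₁ : q < 1) (a : ℕ) :
    HasSum (fun n : ℕ => C * q ^ (n + a)) (C * q ^ a / (1 - q)) := by
  simpa only [pow_add, mul_assoc, mul_comm (q ^ a), div_eq_mul_inv] using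
    (hasSum_geometric_of_lt_one hq₀.le hq₁).mul_left (C * q ^ a)

variable [CompleteSpace E]

lemma summable_of_norm_le_mul_pow_natAbs (hq₀ : 0 < q) (hq₁ : q < 1)
    (hF : ∀ k : ℤ, ‖F k‖ ≤ C * q ^ k.natAbs) : Summable F := by
  refine Summable.of_nat_of_neg_add_one
    (.of_norm_bounded (hasSum_const_mul_pow_add C hq₀ hq₁ 0).summable fun n => ?_)
    (.of_norm_bounded (hasSum_const_mul_pow_add C hq₀ hq₁ 1).summable fun n => ?_)
  · simpa using hF n
  · exact (hF _).trans_eq (by congr 2)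

lemma norm_tsum_sub_sum_range_sub_le (hq₀ : 0 < q) (hq₁ : q < 1)
    (hF : ∀ k : ℤ, ‖F k‖ ≤ C * q ^ k.natAbs) {l N : ℕ} (hl : l < N) :
    ‖∑' k, F k - ∑ k ∈ Finset.range N, F ((k : ℤ) - l)‖
      ≤ C * q ^ (N - l) / (1 - q) + C * q ^ (l + 1) / (1 - q) := by
  have hs : Summable fun k : ℤ => F (k - l) :=
    (summable_of_norm_le_mul_pow_natAbs hq₀ hq₁ hF).comp_injective sub_left_injective
  have hnonneg : Summable fun k : ℕ => F ((k : ℤ) - l) :=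
    hs.comp_injective (i := fun k : ℕ => (k : ℤ)) Nat.cast_injective
  have hneg : Summable fun k : ℕ => F (-((k : ℤ) + 1) - l) :=
    hs.comp_injective (i := fun k : ℕ => -((k : ℤ) + 1)) fun a b h => by simp only at h; omega
  have hsplit : ∑' k, F k
      = ∑' k : ℕ, F ((k : ℤ) - l) + ∑' k : ℕ, F (-((k : ℤ) + 1) - l) :=
    ((Equiv.subRight (l : ℤ)).tsum_eq F).symm.trans (tsum_of_nat_of_neg_add_one hnonneg hneg)
  rw [hsplit, ← hnonneg.sum_add_tsum_nat_add N, add_sub_right_comm, add_sub_cancel_left]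
  refine (norm_add_le _ _).trans (add_le_add ?_ ?_)
  · refine tsum_of_norm_bounded (hasSum_const_mul_pow_add C hq₀ hq₁ (N - l)) fun n =>
      (hF _).trans_eq ?_
    congr 2
    omega
  · refine tsum_of_norm_bounded (hasSum_const_mul_pow_add C hq₀ hq₁ (l + 1)) fun n =>
      (hF _).trans_eq ?_
    congr 2
    omega

lemma sum_range_pow_succ_le (hq₀ : 0 < q) (hq₁ : q < 1) (N : ℕ) :
    ∑ l ∈ Finset.range N, q ^ (l + 1) ≤ q / (1 - q) := by
  simpa using sum_le_hasSum (Finset.range N) (fun l _ => by positivity)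
    (hasSum_const_mul_pow_add 1 hq₀ hq₁ 1)

lemma sum_range_pow_sub_le (hq₀ : 0 < q) (hq₁ : q < 1) (N : ℕ) :
    ∑ l ∈ Finset.range N, q ^ (N - l) ≤ q / (1 - q) := by
  rw [← Finset.sum_range_reflect]
  refine le_of_eq_of_le (Finset.sum_congr rfl fun l hl => ?_) (sum_range_pow_succ_le hq₀ hq₁ N)
  have := Finset.mem_range.1 hl
  congr 1
  omega

lemma norm_tsum_sub_average_sum_range_sub_le [NormedSpace ℝ E] (hq₀ : 0 < q) (hq₁ : q < 1)
    (hF : ∀ k : ℤ, ‖F k‖ ≤ C * q ^ k.natAbs) {N : ℕ} (hN : N ≠ 0) :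
    ‖∑' k, F k - (1 / (N : ℝ)) • ∑ l ∈ Finset.range N, ∑ k ∈ Finset.range N, F ((k : ℤ) - l)‖
      ≤ 2 * C * q / ((1 - q) ^ 2 * N) := by
  have hC : 0 ≤ C := by simpa using (norm_nonneg _).trans (hF 0)
  have hq : 0 < 1 - q := sub_pos.2 hq₁
  have hN₀ : (0 : ℝ) < N := by positivity
  have hsub : ∑' k, F k
      - (1 / (N : ℝ)) • ∑ l ∈ Finset.range N, ∑ k ∈ Finset.range N, F ((k : ℤ) - l)
      = (1 / (N : ℝ)) • ∑ l ∈ Finset.range N,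
          (∑' k, F k - ∑ k ∈ Finset.range N, F ((k : ℤ) - l)) := by
    rw [Finset.sum_sub_distrib, smul_sub, Finset.sum_const, Finset.card_range,
      ← Nat.cast_smul_eq_nsmul ℝ, smul_smul, one_div, inv_mul_cancel₀ hN₀.ne', one_smul]
  rw [hsub, norm_smul, Real.norm_of_nonneg (by positivity)]
  calc 1 / (N : ℝ) * ‖∑ l ∈ Finset.range N, (∑' k, F k - ∑ k ∈ Finset.range N, F ((k : ℤ) - l))‖
      ≤ 1 / (N : ℝ) *
          ∑ l ∈ Finset.range N, (C * q ^ (N - l) / (1 - q) + C * q ^ (l + 1) / (1 - q)) := by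
        gcongr
        exact norm_sum_le_of_le _ fun l hl =>
          norm_tsum_sub_sum_range_sub_le hq₀ hq₁ hF (Finset.mem_range.1 hl)
    _ = 1 / (N : ℝ) * (C / (1 - q) *
          (∑ l ∈ Finset.range N, q ^ (N - l) + ∑ l ∈ Finset.range N, q ^ (l + 1))) := by
        rw [← Finset.sum_add_distrib, Finset.mul_sum _ _ (C / (1 - q))]
        congr! 2 with l
        ring
    _ ≤ 1 / (N : ℝ) * (C / (1 - q) * (q / (1 - q) + q / (1 - q))) := by
        gcongr
        · exact sum_range_pow_sub_le hq₀ hq₁ N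
        · exact sum_range_pow_succ_le hq₀ hq₁ N
    _ = 2 * C * q / ((1 - q) ^ 2 * N) := by
        field_simp
        ring

end BilateralSeries

section Symbol

variable {ι : Type*}

/-- The `k`-th term of the Fourier series with coefficients `D`. -/
noncomputable def symbolTerm (D : ℤ → Matrix ι ι ℝ) (θ : ℝ) (k : ℤ) : Matrix ι ι ℂ :=
  Complex.exp (-(Complex.I * θ * k)) • (D k).map (fun r : ℝ => (r : ℂ))

/-- The symbol `∑_k D_k e^{-iθk}` of the block Toeplitz operator with blocks `D (k - l)`, summed
entrywise so that `psdm P x` is by definition the symbol of `autocorr P x`. -/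
noncomputable def symbol (D : ℤ → Matrix ι ι ℝ) (θ : ℝ) : Matrix ι ι ℂ :=
  Matrix.of fun i j => ∑' k : ℤ, (D k i j : ℂ) * Complex.exp (-(Complex.I * θ * k))

/-- The `N`-th Fejér mean of the symbol of `D`. -/
noncomputable def fejerMean (D : ℤ → Matrix ι ι ℝ) (N : ℕ) (θ : ℝ) : Matrix ι ι ℂ :=
  (1 / (N : ℝ)) • ∑ l ∈ Finset.range N, ∑ k ∈ Finset.range N, symbolTerm D θ ((k : ℤ) - l)

variable {D : ℤ → Matrix ι ι ℝ}

lemma norm_exp_neg_I_mul (θ : ℝ) (k : ℤ) : ‖Complex.exp (-(Complex.I * θ * k))‖ = 1 := by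
  simpa [mul_assoc] using Complex.norm_exp_I_mul_ofReal (-(θ * k))

lemma summable_ofReal_mul_exp {a : ℤ → ℝ} (ha : Summable a) (θ : ℝ) :
    Summable fun k : ℤ => (a k : ℂ) * Complex.exp (-(Complex.I * θ * k)) :=
  .of_norm <| by simpa [norm_exp_neg_I_mul] using ha.abs

lemma hasSum_symbolTerm (hD : Summable D) (θ : ℝ) : HasSum (symbolTerm D θ) (symbol D θ) := by
  refine Pi.hasSum.2 fun i => Pi.hasSum.2 fun j => ?_
  simpa [symbolTerm, symbol, mul_comm] using
    (summable_ofReal_mul_exp (Pi.summable.1 (Pi.summable.1 hD i) j) θ).hasSum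

variable [Fintype ι]

lemma norm_sq_eq_re_add_im (z : EuclideanSpace ℂ ι) :
    ‖z‖ ^ 2 = ‖(WithLp.toLp 2 fun i => (z i).re : EuclideanSpace ℝ ι)‖ ^ 2
      + ‖(WithLp.toLp 2 fun i => (z i).im : EuclideanSpace ℝ ι)‖ ^ 2 := by
  simp only [EuclideanSpace.norm_sq_eq, ← Finset.sum_add_distrib, Complex.sq_norm,
    Complex.normSq_apply, Real.norm_eq_abs, sq_abs]
  simp only [sq]

variable [DecidableEq ι]

lemma norm_map_ofReal_le (A : Matrix ι ι ℝ) : ‖A.map (fun r : ℝ => (r : ℂ))‖ ≤ ‖A‖ := by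
  rw [Matrix.cstar_norm_def]
  refine ContinuousLinearMap.opNorm_le_bound _ (norm_nonneg A) fun z => ?_
  let T := Matrix.toEuclideanCLM (n := ι) (𝕜 := ℝ) A
  let a : EuclideanSpace ℝ ι := WithLp.toLp 2 fun i => (z i).re
  let b : EuclideanSpace ℝ ι := WithLp.toLp 2 fun i => (z i).im
  refine le_of_sq_le_sq ?_ (by positivity)
  calc ‖Matrix.toEuclideanCLM (n := ι) (𝕜 := ℂ) (A.map (fun r : ℝ => (r : ℂ))) z‖ ^ 2
      = ‖T a‖ ^ 2 + ‖T b‖ ^ 2 := by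
        rw [norm_sq_eq_re_add_im]
        congr! 3 <;> ext i <;>
          simp [T, a, b, Matrix.ofLp_toEuclideanCLM, Matrix.mulVec, dotProduct]
    _ ≤ (‖A‖ * ‖a‖) ^ 2 + (‖A‖ * ‖b‖) ^ 2 := by
        gcongr <;> exact T.le_opNorm _
    _ = (‖A‖ * ‖z‖) ^ 2 := by
        rw [mul_pow _ ‖z‖, norm_sq_eq_re_add_im z]
        ring

lemma norm_symbolTerm_le (D : ℤ → Matrix ι ι ℝ) (θ : ℝ) (k : ℤ) :
    ‖symbolTerm D θ k‖ ≤ ‖D k‖ := by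
  rw [symbolTerm, norm_smul, norm_exp_neg_I_mul, one_mul]
  exact norm_map_ofReal_le (D k)

lemma norm_symbol_sub_fejerMean_le {C q : ℝ} (hq₀ : 0 < q) (hq₁ : q < 1)
    (hD : ∀ k, ‖D k‖ ≤ C * q ^ k.natAbs) {N : ℕ} (hN : N ≠ 0) (θ : ℝ) :
    ‖symbol D θ - fejerMean D N θ‖ ≤ 2 * C * q / ((1 - q) ^ 2 * N) := by
  have hs : Summable D := summable_of_norm_le_mul_pow_natAbs hq₀ hq₁ hD
  rw [← (hasSum_symbolTerm hs θ).tsum_eq]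
  exact norm_tsum_sub_average_sum_range_sub_le hq₀ hq₁
    (fun k => (norm_symbolTerm_le D θ k).trans (hD k)) hN

end Symbol

section Autocorrelation

variable {Ω : Type*} [MeasurableSpace Ω] {P : Measure Ω} {p : ℕ} {x : ℤ → Ω → Fin p → ℝ}
  {C ρ : ℝ}

lemma AutocorrDecay.norm_le (hR : AutocorrDecay P x C ρ) (k : ℤ) :
    ‖autocorr P x k‖ ≤ C * ρ⁻¹ ^ k.natAbs := by
  refine (hR.2.2 k).trans_eq ?_
  rw [zpow_neg, Int.abs_eq_natAbs, zpow_natCast, inv_pow]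

lemma AutocorrDecay.inv_pos (hR : AutocorrDecay P x C ρ) : 0 < ρ⁻¹ :=
  _root_.inv_pos.2 (one_pos.trans hR.2.1)

lemma AutocorrDecay.inv_lt_one (hR : AutocorrDecay P x C ρ) : ρ⁻¹ < 1 :=
  inv_lt_one_of_one_lt₀ hR.2.1

lemma AutocorrDecay.summable (hR : AutocorrDecay P x C ρ) : Summable (autocorr P x) :=
  summable_of_norm_le_mul_pow_natAbs hR.inv_pos hR.inv_lt_one hR.norm_le

lemma AutocorrDecay.ne_zero_of_lt (hR : AutocorrDecay P x C ρ) {N : ℕ} {ε : ℝ} (hε : 0 < ε)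
    (hN : 2 * C * ρ⁻¹ / ((1 - ρ⁻¹) ^ 2 * ε) < N) : N ≠ 0 := by
  have hC : 0 < C := hR.1
  have hρ₀ : 0 < ρ⁻¹ := hR.inv_pos
  have hNpos : (0 : ℝ) < N := lt_of_le_of_lt (by positivity) hN
  exact_mod_cast hNpos.ne'

lemma AutocorrDecay.norm_psdm_sub_fejerMean_lt (hR : AutocorrDecay P x C ρ) {N : ℕ} {ε : ℝ}
    (hε : 0 < ε) (hN : 2 * C * ρ⁻¹ / ((1 - ρ⁻¹) ^ 2 * ε) < N) (θ : ℝ) :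
    ‖psdm P x θ - fejerMean (autocorr P x) N θ‖ < ε := by
  have hρ₁ : 0 < 1 - ρ⁻¹ := sub_pos.2 hR.inv_lt_one
  have hN₀ : N ≠ 0 := hR.ne_zero_of_lt hε hN
  refine (norm_symbol_sub_fejerMean_le hR.inv_pos hR.inv_lt_one hR.norm_le hN₀ θ).trans_lt ?_
  rw [div_lt_iff₀ (by positivity)] at hN ⊢
  linarith

end Autocorrelation

section Toeplitz

lemma integral_exp_I_mul_int (m : ℤ) :
    ∫ θ in (0 : ℝ)..2 * Real.pi, Complex.exp (Complex.I * θ * m)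
      = if m = 0 then 2 * Real.pi else 0 := by
  split_ifs with hm
  · simp [hm]
  · have hc : Complex.I * (m : ℂ) ≠ 0 := mul_ne_zero Complex.I_ne_zero (by exact_mod_cast hm)
    have hperiod : Complex.exp (Complex.I * m * ((2 * Real.pi : ℝ) : ℂ)) = 1 := by
      rw [← Complex.exp_int_mul_two_pi_mul_I m]
      congr 1
      push_cast
      ring
    have hcomm : ∀ θ : ℝ, Complex.I * θ * m = Complex.I * m * θ := fun θ => mul_right_comm _ _ _
    simp only [hcomm]
    rw [integral_exp_mul_complex hc, hperiod]
    simp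

lemma continuous_tsum_mul_exp {a : ℤ → ℝ} (ha : Summable a) :
    Continuous fun θ : ℝ => ∑' k, (a k : ℂ) * Complex.exp (-(Complex.I * θ * k)) :=
  continuous_tsum (fun k => by fun_prop) ha.abs fun k θ => by
    rw [norm_mul, norm_exp_neg_I_mul, mul_one, Complex.norm_real, Real.norm_eq_abs]

lemma integral_tsum_mul_exp_mul_exp {a : ℤ → ℝ} (ha : Summable a) (m : ℤ) :
    ∫ θ in (0 : ℝ)..2 * Real.pi,
        (∑' k, (a k : ℂ) * Complex.exp (-(Complex.I * θ * k))) * Complex.exp (Complex.I * θ * m)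
      = 2 * Real.pi * a m := by
  have hshift : ∀ (θ : ℝ) (k : ℤ),
      (a k : ℂ) * Complex.exp (-(Complex.I * θ * k)) * Complex.exp (Complex.I * θ * m)
        = a k * Complex.exp (Complex.I * θ * ((m - k : ℤ) : ℂ)) := by
    intro θ k
    rw [mul_assoc, ← Complex.exp_add]
    congr 2
    push_cast
    ring
  have hnorm : ∀ (θ : ℝ) (k : ℤ),
      ‖(a k : ℂ) * Complex.exp (Complex.I * θ * ((m - k : ℤ) : ℂ))‖ = |a k| := by
    intro θ k
    have := norm_exp_neg_I_mul θ (k - m)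
    rw [norm_mul, Complex.norm_real, Real.norm_eq_abs, ← neg_sub k m, Int.cast_neg, mul_neg, this,
      mul_one]
  have hswap := intervalIntegral.hasSum_integral_of_dominated_convergence (μ := volume)
    (a := 0) (b := 2 * Real.pi)
    (F := fun (k : ℤ) (θ : ℝ) => (a k : ℂ) * Complex.exp (Complex.I * θ * ((m - k : ℤ) : ℂ)))
    (f := fun θ : ℝ => (∑' k, (a k : ℂ) * Complex.exp (-(Complex.I * θ * k)))
      * Complex.exp (Complex.I * θ * m))
    (fun k _ => |a k|) (fun k => by fun_prop)
    (fun k => ae_of_all _ fun θ _ => (hnorm θ k).le) (ae_of_all _ fun θ _ => ha.abs) (by simp)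
    (ae_of_all _ fun θ _ => by
      simpa only [hshift] using
        (summable_ofReal_mul_exp ha θ).hasSum.mul_right (Complex.exp (Complex.I * θ * m)))
  rw [← hswap.tsum_eq]
  simp_rw [intervalIntegral.integral_const_mul, integral_exp_I_mul_int]
  rw [tsum_eq_single m fun k hk => by simp [sub_eq_zero, hk.symm]]
  simp [mul_comm]

variable {ι : Type*} {D : ℤ → Matrix ι ι ℝ}

lemma continuous_symbol_apply (hD : Summable D) (i j : ι) : Continuous fun θ => symbol D θ i j :=
  continuous_tsum_mul_exp (Pi.summable.1 (Pi.summable.1 hD i) j)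

lemma integral_symbol_apply_mul_exp (hD : Summable D) (i j : ι) (m : ℤ) :
    ∫ θ in (0 : ℝ)..2 * Real.pi, symbol D θ i j * Complex.exp (Complex.I * θ * m)
      = 2 * Real.pi * D m i j :=
  integral_tsum_mul_exp_mul_exp (Pi.summable.1 (Pi.summable.1 hD i) j) m

lemma symbol_single_zero_sub (hD : Summable D) (A : Matrix ι ι ℝ) (θ : ℝ) :
    symbol (Pi.single 0 A - D) θ = A.map (fun r : ℝ => (r : ℂ)) - symbol D θ := by
  ext i j
  have hA : HasSum (fun k : ℤ => ((Pi.single 0 A : ℤ → Matrix ι ι ℝ) k i j : ℂ)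
      * Complex.exp (-(Complex.I * θ * k))) (A i j : ℂ) := by
    convert hasSum_single (0 : ℤ) fun k hk => ?_ using 1
    · simp
    · simp [hk]
  have hsub := hA.sub (summable_ofReal_mul_exp (Pi.summable.1 (Pi.summable.1 hD i) j) θ).hasSum
  simpa [symbol, sub_mul] using hsub.tsum_eq

variable {α : Type*} [Fintype α]

section TrigVector

variable [DecidableEq ι]

/-- The vector of trigonometric polynomials `θ ↦ ∑_a u_a e^{-iθτ(a)} δ_{c(a)}`, whose quadratic
form under the symbol of `D` averages over a period to a block Toeplitz form. -/
noncomputable def trigVector (τ : α → ℤ) (c : α → ι) (u : α → ℝ) (θ : ℝ) : ι → ℂ :=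
  ∑ a, Pi.single (c a) ((u a : ℂ) * Complex.exp (-(Complex.I * θ * τ a)))

variable [Fintype ι]

lemma star_dotProduct_mulVec_sum_single (A : Matrix ι ι ℂ) (c : α → ι) (w : α → ℂ) :
    star (∑ a, Pi.single (c a) (w a) : ι → ℂ) ⬝ᵥ A.mulVec (∑ a, Pi.single (c a) (w a))
      = ∑ a, ∑ b, star (w a) * w b * A (c a) (c b) := by
  simp only [star_sum, Matrix.mulVec_sum, sum_dotProduct, dotProduct_sum, Pi.star_single,
    single_dotProduct, Matrix.mulVec_single]
  rw [Finset.sum_comm]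
  refine Finset.sum_congr rfl fun a _ => Finset.sum_congr rfl fun b _ => ?_
  simp only [Pi.smul_apply, Matrix.col_apply, MulOpposite.smul_eq_mul_unop, MulOpposite.unop_op]
  ring

lemma star_trigVector_dotProduct_symbol_mulVec (D : ℤ → Matrix ι ι ℝ) (τ : α → ℤ) (c : α → ι)
    (u : α → ℝ) (θ : ℝ) :
    star (trigVector τ c u θ) ⬝ᵥ (symbol D θ).mulVec (trigVector τ c u θ)
      = ∑ a, ∑ b, ((u a * u b : ℝ) : ℂ) *
          (symbol D θ (c a) (c b) * Complex.exp (Complex.I * θ * ((τ a - τ b : ℤ) : ℂ))) := by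
  rw [trigVector, star_dotProduct_mulVec_sum_single]
  congr! 2 with a _ b
  have hstar : star ((u a : ℂ) * Complex.exp (-(Complex.I * θ * τ a)))
      = u a * Complex.exp (Complex.I * θ * τ a) := by
    simp [← Complex.exp_conj]
  have hexp : Complex.exp (Complex.I * θ * ((τ a - τ b : ℤ) : ℂ))
      = Complex.exp (Complex.I * θ * τ a) * Complex.exp (-(Complex.I * θ * τ b)) := by
    rw [← Complex.exp_add]
    congr 1
    push_cast
    ring
  rw [hstar, hexp]
  push_cast
  ring

lemma continuous_star_trigVector_dotProduct_symbol_mulVec (hD : Summable D) (τ : α → ℤ) (c : α → ι)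
    (u : α → ℝ) :
    Continuous fun θ =>
      star (trigVector τ c u θ) ⬝ᵥ (symbol D θ).mulVec (trigVector τ c u θ) := by
  simp_rw [star_trigVector_dotProduct_symbol_mulVec]
  have := continuous_symbol_apply hD
  fun_prop

lemma integral_star_trigVector_dotProduct_symbol_mulVec (hD : Summable D) (τ : α → ℤ) (c : α → ι)
    (u : α → ℝ) :
    ∫ θ in (0 : ℝ)..2 * Real.pi,
        star (trigVector τ c u θ) ⬝ᵥ (symbol D θ).mulVec (trigVector τ c u θ)
      = ((2 * Real.pi * ∑ a, ∑ b, u a * u b * D (τ a - τ b) (c a) (c b) : ℝ) : ℂ) := by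
  have hcont := continuous_symbol_apply hD
  simp_rw [star_trigVector_dotProduct_symbol_mulVec]
  rw [intervalIntegral.integral_finsetSum fun a _ =>
    Continuous.intervalIntegrable (by fun_prop) _ _]
  simp_rw [fun a => intervalIntegral.integral_finsetSum (s := Finset.univ) (μ := volume)
      (a := 0) (b := 2 * Real.pi)
      (f := fun b θ => ((u a * u b : ℝ) : ℂ) *
        (symbol D θ (c a) (c b) * Complex.exp (Complex.I * θ * ((τ a - τ b : ℤ) : ℂ))))
      fun b _ => Continuous.intervalIntegrable (by fun_prop) _ _,
    intervalIntegral.integral_const_mul, integral_symbol_apply_mul_exp hD]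
  push_cast
  simp only [Finset.mul_sum]
  congr! 2
  ring

end TrigVector

open scoped ComplexOrder in
lemma sum_toeplitz_nonneg [Finite ι] (hD : Summable D)
    (hpos : ∀ θ ∈ Set.Icc 0 (2 * Real.pi), (symbol D θ).PosSemidef)
    (τ : α → ℤ) (c : α → ι) (u : α → ℝ) :
    0 ≤ ∑ a, ∑ b, u a * u b * D (τ a - τ b) (c a) (c b) := by
  classical
  have := Fintype.ofFinite ι
  have hre := Complex.reCLM.intervalIntegral_comp_comm
    ((continuous_star_trigVector_dotProduct_symbol_mulVec hD τ c u).intervalIntegrable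
      (μ := volume) 0 (2 * Real.pi))
  rw [integral_star_trigVector_dotProduct_symbol_mulVec hD, Complex.reCLM_apply,
    Complex.ofReal_re] at hre
  refine nonneg_of_mul_nonneg_right (hre ▸ ?_) Real.two_pi_pos
  exact intervalIntegral.integral_nonneg Real.two_pi_pos.le fun θ hθ =>
    (Complex.le_def.1 ((hpos θ hθ).dotProduct_mulVec_nonneg _)).1

open scoped ComplexOrder MatrixOrder in
lemma sum_toeplitz_le [Fintype ι] [DecidableEq ι] {M : ℝ} (hD : Summable D)
    (hM : ∀ θ ∈ Set.Icc 0 (2 * Real.pi), symbol D θ ≤ algebraMap ℝ (Matrix ι ι ℂ) M)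
    {τ : α → ℤ} {c : α → ι} (hinj : Function.Injective fun a => (τ a, c a)) (u : α → ℝ) :
    ∑ a, ∑ b, u a * u b * D (τ a - τ b) (c a) (c b) ≤ M * ∑ a, u a ^ 2 := by
  classical
  let S : ℤ → Matrix ι ι ℝ := Pi.single 0 (algebraMap ℝ _ M)
  have hS : Summable S := (hasSum_single (0 : ℤ) fun k hk => Pi.single_eq_of_ne hk _).summable
  have hS_apply : ∀ a b, S (τ a - τ b) (c a) (c b) = if a = b then M else 0 := by
    intro a b
    have hab : a = b ↔ τ a - τ b = 0 ∧ c a = c b := by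
      rw [← hinj.eq_iff, Prod.mk.injEq, sub_eq_zero]
    by_cases hτ : τ a - τ b = 0 <;>
      simp [S, hab, hτ, Matrix.algebraMap_matrix_apply]
  have hsymbol : ∀ θ, symbol (S - D) θ = algebraMap ℝ (Matrix ι ι ℂ) M - symbol D θ := by
    intro θ
    rw [symbol_single_zero_sub hD]
    ext i j
    by_cases hij : i = j <;> simp [Matrix.algebraMap_matrix_apply, hij]
  have hnonneg := sum_toeplitz_nonneg (D := S - D) (hS.sub hD)
    (fun θ hθ => hsymbol θ ▸ Matrix.le_iff.1 (hM θ hθ)) τ c u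
  simp only [Pi.sub_apply, Matrix.sub_apply, mul_sub, Finset.sum_sub_distrib, hS_apply, mul_ite,
    mul_zero, Finset.sum_ite_eq, Finset.mem_univ, if_true, ← sq, mul_comm _ M,
    ← Finset.mul_sum] at hnonneg
  exact sub_nonneg.1 hnonneg

end Toeplitz

section SpectralBound

variable {ι : Type*} {D : ℤ → Matrix ι ι ℝ}

lemma conjTranspose_symbolTerm (hD : ∀ k, D (-k) = (D k).transpose) (θ : ℝ) (k : ℤ) :
    (symbolTerm D θ k).conjTranspose = symbolTerm D θ (-k) := by
  ext i j
  simp [symbolTerm, hD, ← Complex.exp_conj]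

lemma isHermitian_symbol (hD : ∀ k, D (-k) = (D k).transpose) (θ : ℝ) :
    (symbol D θ).IsHermitian := by
  have hsymbol : ∀ i j, symbol D θ i j = ∑' k, symbolTerm D θ k i j := fun i j => by
    simp only [symbol, symbolTerm, Matrix.of_apply, Matrix.smul_apply, Matrix.map_apply,
      smul_eq_mul, mul_comm]
  ext i j
  rw [Matrix.conjTranspose_apply, hsymbol, hsymbol, tsum_star, ← (Equiv.neg ℤ).tsum_eq]
  refine tsum_congr fun k => ?_
  rw [Equiv.neg_apply, ← Matrix.conjTranspose_apply, conjTranspose_symbolTerm hD, neg_neg]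

lemma isHermitian_fejerMean (hD : ∀ k, D (-k) = (D k).transpose) (N : ℕ) (θ : ℝ) :
    (fejerMean D N θ).IsHermitian := by
  rw [Matrix.IsHermitian, fejerMean, Matrix.conjTranspose_smul, star_trivial]
  simp only [Matrix.conjTranspose_sum, conjTranspose_symbolTerm hD, neg_sub]
  rw [Finset.sum_comm]

open scoped MatrixOrder in
lemma sum_autocorr_le {Ω : Type*} [MeasurableSpace Ω] {P : Measure Ω} {p : ℕ}
    {x : ℤ → Ω → Fin p → ℝ} {C ρ M : ℝ} (hR : AutocorrDecay P x C ρ)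
    (hsymm : ∀ k, autocorr P x (-k) = (autocorr P x k).transpose)
    (hM : ∀ θ ∈ Set.Icc 0 (2 * Real.pi), ∀ μ ∈ spectrum ℝ (psdm P x θ), μ ≤ M)
    {α : Type*} [Fintype α] {τ : α → ℤ} {c : α → Fin p}
    (hinj : Function.Injective fun a => (τ a, c a)) (u : α → ℝ) :
    ∑ a, ∑ b, u a * u b * autocorr P x (τ a - τ b) (c a) (c b) ≤ M * ∑ a, u a ^ 2 :=
  sum_toeplitz_le hR.summable (fun θ hθ =>
    le_algebraMap_of_spectrum_le (hM θ hθ) (isHermitian_symbol hsymm θ)) hinj u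

end SpectralBound

section ShiftSpan

variable {E ι : Type*} [NormedAddCommGroup E]

/-- The closure, for pointwise convergence, of the linear combinations of time shifts of the
sequences `ε i`. Filtering the sequences `ε i`, possibly repeatedly, never leaves this space. -/
def shiftSpan [NormedSpace ℝ E] (ε : ι → ℤ → E) : Submodule ℝ (ℤ → E) :=
  (Submodule.span ℝ (Set.range fun (a : ι × ℤ) k => ε a.1 (k - a.2))).topologicalClosure

section NormedSpace

variable [NormedSpace ℝ E]

lemma isClosed_shiftSpan (ε : ι → ℤ → E) : IsClosed (shiftSpan ε : Set (ℤ → E)) :=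
  Submodule.isClosed_topologicalClosure _

lemma shift_mem_shiftSpan (ε : ι → ℤ → E) (i : ι) (l : ℤ) :
    (fun k => ε i (k - l)) ∈ shiftSpan ε :=
  Submodule.le_topologicalClosure _ (Submodule.subset_span ⟨(i, l), rfl⟩)

lemma mem_shiftSpan (ε : ι → ℤ → E) (i : ι) : ε i ∈ shiftSpan ε := by
  simpa using shift_mem_shiftSpan ε i 0

lemma shiftSpan_le {ε : ι → ℤ → E} {S : Submodule ℝ (ℤ → E)} (hS : IsClosed (S : Set (ℤ → E)))
    (h : ∀ i l, (fun k => ε i (k - l)) ∈ S) : shiftSpan ε ≤ S :=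
  Submodule.topologicalClosure_minimal _
    (Submodule.span_le.2 (Set.range_subset_iff.2 fun a => h a.1 a.2)) hS

lemma shift_mem_shiftSpan_of_mem {ε : ι → ℤ → E} {F : ℤ → E} (hF : F ∈ shiftSpan ε) (m : ℤ) :
    (fun k => F (k - m)) ∈ shiftSpan ε := by
  let T : (ℤ → E) →L[ℝ] (ℤ → E) := .pi fun k => .proj (k - m)
  have hle : shiftSpan ε ≤ (shiftSpan ε).comap T.toLinearMap :=
    shiftSpan_le ((isClosed_shiftSpan ε).preimage T.continuous) fun i l => by
      change (fun k => ε i (k - m - l)) ∈ shiftSpan ε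
      simpa only [sub_sub] using shift_mem_shiftSpan ε i (m + l)
  exact hle hF

lemma eval_mem_of_mem_shiftSpan {ε : ι → ℤ → E} {F : ℤ → E} (hF : F ∈ shiftSpan ε) (k : ℤ) :
    F k ∈ (Submodule.span ℝ (Set.range fun a : ι × ℤ => ε a.1 a.2)).topologicalClosure := by
  let π : (ℤ → E) →L[ℝ] E := .proj k
  have hle : shiftSpan ε ≤
      (Submodule.span ℝ (Set.range fun a : ι × ℤ => ε a.1 a.2)).topologicalClosure.comap
        π.toLinearMap :=
    shiftSpan_le ((Submodule.isClosed_topologicalClosure _).preimage π.continuous) fun i l =>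
      Submodule.le_topologicalClosure _ (Submodule.subset_span ⟨(i, k - l), rfl⟩)
  exact hle hF

end NormedSpace

variable [InnerProductSpace ℝ E]

lemma inner_shift_right_of_mem_shiftSpan {ε : ι → ℤ → E} {H F : ℤ → E} {m : ℤ}
    (hH : ∀ i k l, inner ℝ (H (k + m)) (ε i (l + m)) = inner ℝ (H k) (ε i l))
    (hF : F ∈ shiftSpan ε) (k l : ℤ) :
    inner ℝ (H (k + m)) (F (l + m)) = inner ℝ (H k) (F l) := by
  let L : (ℤ → E) →L[ℝ] ℝ :=
    (innerSL ℝ (H (k + m))).comp (.proj (l + m)) - (innerSL ℝ (H k)).comp (.proj l)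
  have hle : shiftSpan ε ≤ L.ker := shiftSpan_le L.isClosed_ker fun i l' => by
    simpa [L, sub_eq_zero, sub_add_eq_add_sub] using hH i k (l - l')
  simpa [L, sub_eq_zero] using hle hF

lemma inner_shift_of_mem_shiftSpan {ε : ι → ℤ → E} {m : ℤ}
    (hε : ∀ i j k l, inner ℝ (ε i (k + m)) (ε j (l + m)) = inner ℝ (ε i k) (ε j l))
    {F G : ℤ → E} (hF : F ∈ shiftSpan ε) (hG : G ∈ shiftSpan ε) (k l : ℤ) :
    inner ℝ (F (k + m)) (G (l + m)) = inner ℝ (F k) (G l) := by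
  refine inner_shift_right_of_mem_shiftSpan (fun i k l => ?_) hG k l
  rw [real_inner_comm, real_inner_comm (ε i l)]
  exact inner_shift_right_of_mem_shiftSpan (fun j k l => hε i j k l) hF l k

end ShiftSpan

section L2

variable {Ω : Type*} [MeasurableSpace Ω] {P : Measure Ω}

lemma inner_eq_integral_of_ae_eq {f g : Ω → ℝ} {F G : Lp ℝ 2 P} (hF : F =ᵐ[P] f)
    (hG : G =ᵐ[P] g) : inner ℝ F G = ∫ ω, f ω * g ω ∂P := by
  rw [L2.inner_def]
  refine integral_congr_ae ?_
  filter_upwards [hF, hG] with ω hFω hGω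
  simp only [hFω, hGω, RCLike.inner_apply, conj_trivial, mul_comm]

lemma coeFn_sum_smul {β : Type*} (s : Finset β) (c : β → ℝ) {F : β → Lp ℝ 2 P} {f : β → Ω → ℝ}
    (hF : ∀ b, F b =ᵐ[P] f b) :
    (∑ b ∈ s, c b • F b : Lp ℝ 2 P) =ᵐ[P] fun ω => ∑ b ∈ s, c b * f b ω := by
  have hterm : ∀ b ∈ s, ∀ᵐ ω ∂P, (c b • F b : Lp ℝ 2 P) ω = c b * f b ω := by
    intro b _
    filter_upwards [Lp.coeFn_smul (c b) (F b), hF b] with ω hsmul hFω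
    rw [hsmul, Pi.smul_apply, hFω, smul_eq_mul]
  filter_upwards [(Finset.eventually_all s).2 hterm,
    Lp.coeFn_fun_finsetSum s fun b => c b • F b] with ω hω hsum
  rw [hsum]
  exact Finset.sum_congr rfl hω

lemma map_eq_gaussianReal_zero_norm_sq {Y : Lp ℝ 2 P} (hY : HasGaussianLaw Y P)
    (h0 : P[Y] = 0) : P.map Y = gaussianReal 0 (‖Y‖ ^ 2).toNNReal := by
  rw [map_eq_gaussianReal_zero_variance hY h0, variance_of_integral_eq_zero hY.aemeasurable h0,
    ← real_inner_self_eq_norm_sq, inner_eq_integral_of_ae_eq .rfl .rfl]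
  simp only [sq]

variable [IsProbabilityMeasure P]

lemma tendsto_charFun_map_of_tendsto_Lp {Y : ℕ → Lp ℝ 2 P} {Z : Lp ℝ 2 P}
    (hY : Tendsto Y atTop (𝓝 Z)) (t : ℝ) :
    Tendsto (fun n => charFun (P.map (Y n)) t) atTop (𝓝 (charFun (P.map Z) t)) :=
  ProbabilityMeasure.tendsto_iff_tendsto_charFun.1
    ((tendstoInMeasure_of_tendsto_Lp hY).tendstoInDistribution
      fun n => (Lp.aestronglyMeasurable (Y n)).aemeasurable).tendsto t

lemma isClosed_setOf_map_eq_gaussianReal :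
    IsClosed {Y : Lp ℝ 2 P | P.map Y = gaussianReal 0 (‖Y‖ ^ 2).toNNReal} := by
  refine IsSeqClosed.isClosed fun Y Z hY hYZ => ?_
  have := Measure.isProbabilityMeasure_map (μ := P) (Lp.aestronglyMeasurable Z).aemeasurable
  refine Measure.ext_of_charFun (funext fun t => ?_)
  refine tendsto_nhds_unique (tendsto_charFun_map_of_tendsto_Lp hYZ t) ?_
  have hchar : ∀ W : Lp ℝ 2 P, charFun (gaussianReal 0 (‖W‖ ^ 2).toNNReal) t
      = Complex.exp (-((‖W‖ ^ 2 * t ^ 2 / 2 : ℝ) : ℂ)) := fun W => by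
    rw [charFun_gaussianReal, Real.coe_toNNReal _ (sq_nonneg _)]
    congr 1
    push_cast
    ring
  have hcont : Continuous fun W : Lp ℝ 2 P => Complex.exp (-((‖W‖ ^ 2 * t ^ 2 / 2 : ℝ) : ℂ)) := by
    fun_prop
  rw [hchar]
  exact ((hcont.tendsto Z).comp hYZ).congr fun n => by
    rw [Function.comp_apply, ← hchar, Set.mem_ofPred.1 (hY n)]

end L2

section InShiftSpan

variable {Ω : Type*} [MeasurableSpace Ω] {P : Measure Ω}

/-- The real process `f` has a version in the closed span of the shifts of the square-integrable
processes `ε i`. -/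
def InShiftSpan {ι : Type*} (P : Measure Ω) (ε : ι → ℤ → Lp ℝ 2 P) (f : ℤ → Ω → ℝ) : Prop :=
  ∃ F ∈ shiftSpan ε, ∀ k, F k =ᵐ[P] f k

namespace InShiftSpan

variable {ι : Type*} {ε : ι → ℤ → Lp ℝ 2 P} {f g : ℤ → Ω → ℝ}

lemma memLp (hf : InShiftSpan P ε f) (k : ℤ) : MemLp (f k) 2 P := by
  obtain ⟨F, -, hFf⟩ := hf
  exact (Lp.memLp (F k)).ae_eq (hFf k)

lemma zero : InShiftSpan P ε fun _ _ => 0 :=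
  ⟨0, Submodule.zero_mem _, fun _ => Lp.coeFn_zero _ _ _⟩

lemma add (hf : InShiftSpan P ε f) (hg : InShiftSpan P ε g) :
    InShiftSpan P ε fun k ω => f k ω + g k ω := by
  obtain ⟨F, hF, hFf⟩ := hf
  obtain ⟨G, hG, hGg⟩ := hg
  exact ⟨F + G, Submodule.add_mem _ hF hG, fun k =>
    (Lp.coeFn_add (F k) (G k)).trans ((hFf k).add (hGg k))⟩

lemma const_mul (c : ℝ) (hf : InShiftSpan P ε f) : InShiftSpan P ε fun k ω => c * f k ω := by
  obtain ⟨F, hF, hFf⟩ := hf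
  exact ⟨c • F, Submodule.smul_mem _ _ hF, fun k =>
    (Lp.coeFn_smul c (F k)).trans ((hFf k).const_smul c)⟩

lemma shift (m : ℤ) (hf : InShiftSpan P ε f) : InShiftSpan P ε fun k => f (k - m) := by
  obtain ⟨F, hF, hFf⟩ := hf
  exact ⟨_, shift_mem_shiftSpan_of_mem hF m, fun k => hFf (k - m)⟩

lemma sum {β : Type*} {s : Finset β} {f : β → ℤ → Ω → ℝ} (hf : ∀ b ∈ s, InShiftSpan P ε (f b)) :
    InShiftSpan P ε fun k ω => ∑ b ∈ s, f b k ω := by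
  classical
  induction s using Finset.induction_on with
  | empty => simpa using zero
  | insert b s hb ih =>
    simp_rw [Finset.sum_insert hb]
    exact (hf b (Finset.mem_insert_self b s)).add
      (ih fun b' hb' => hf b' (Finset.mem_insert_of_mem hb'))

lemma of_tendsto {g : ℕ → ℤ → Ω → ℝ} (hg : ∀ K, InShiftSpan P ε (g K))
    (hf : ∀ k, AEStronglyMeasurable (f k) P)
    (hlim : ∀ k, Tendsto (fun K => eLpNorm (fun ω => f k ω - g K k ω) 2 P) atTop (𝓝 0)) :
    InShiftSpan P ε f := by
  have hf2 : ∀ k, MemLp (f k) 2 P := fun k => by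
    obtain ⟨K, hK⟩ := ((hlim k).eventually_lt_const zero_lt_one).exists
    have hsub : MemLp (fun ω => f k ω - g K k ω) 2 P :=
      ⟨(hf k).sub ((hg K).memLp k).1, hK.trans ENNReal.one_lt_top⟩
    exact (hsub.add ((hg K).memLp k)).ae_eq (ae_of_all _ fun ω => sub_add_cancel _ _)
  choose G hG hGg using hg
  refine ⟨fun k => (hf2 k).toLp, ?_, fun k => (hf2 k).coeFn_toLp⟩
  refine (isClosed_shiftSpan ε).mem_of_tendsto (b := atTop) (tendsto_pi_nhds.2 fun k => ?_)
    (Eventually.of_forall hG)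
  rw [tendsto_iff_edist_tendsto_0]
  refine (hlim k).congr fun K => ?_
  rw [edist_comm, Lp.edist_def]
  exact eLpNorm_congr_ae ((hf2 k).coeFn_toLp.sub (hGg K k)).symm

end InShiftSpan

end InShiftSpan

section StationaryGaussian

variable {Ω : Type*} [MeasurableSpace Ω] {P : Measure Ω} {p : ℕ} {x z : ℤ → Ω → Fin p → ℝ}

/-- A centred wide-sense stationary (jointly) Gaussian process. Unlike `IsExogenousNoise`, its
coordinates may be correlated, so that the notion also covers the states of the system. -/
structure IsStationaryGaussian (P : Measure Ω) (z : ℤ → Ω → Fin p → ℝ) : Prop where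
  gaussian : IsGaussianProcess z P
  zero_mean : ∀ k i, ∫ ω, z k ω i ∂P = 0
  stationary : ∀ k l i j, ∫ ω, z (k + l) ω i * z l ω j ∂P = ∫ ω, z k ω i * z 0 ω j ∂P

lemma IsExogenousNoise.isStationaryGaussian (hz : IsExogenousNoise P z) :
    IsStationaryGaussian P z :=
  ⟨hz.gaussian, hz.zero_mean, hz.stationary⟩

namespace IsStationaryGaussian

lemma isGaussianProcess_coord (hz : IsStationaryGaussian P z) :
    IsGaussianProcess (fun (a : Fin p × ℤ) ω => z a.2 ω a.1) P :=
  (hz.gaussian.comp_right Prod.snd).comp_left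
    fun a => ContinuousLinearMap.proj (R := ℝ) (φ := fun _ : Fin p => ℝ) a.1

lemma memLp (hz : IsStationaryGaussian P z) (i : Fin p) (k : ℤ) :
    MemLp (fun ω => z k ω i) 2 P :=
  (hz.isGaussianProcess_coord.hasGaussianLaw_eval (i, k)).memLp_two

lemma integral_mul_eq_autocorr (hz : IsStationaryGaussian P z) (i j : Fin p) (k l : ℤ) :
    ∫ ω, z k ω i * z l ω j ∂P = autocorr P z (k - l) i j := by
  simpa [autocorr] using hz.stationary (k - l) l i j

lemma autocorr_neg (hz : IsStationaryGaussian P z) (k : ℤ) :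
    autocorr P z (-k) = (autocorr P z k).transpose := by
  ext i j
  rw [Matrix.transpose_apply, ← zero_sub k, ← sub_zero k, ← hz.integral_mul_eq_autocorr j i k 0,
    sub_zero, ← hz.integral_mul_eq_autocorr i j 0 k]
  simp only [mul_comm]

/-- The coordinates of the process as elements of `L²`. -/
noncomputable def lp (hz : IsStationaryGaussian P z) (i : Fin p) (k : ℤ) : Lp ℝ 2 P :=
  (hz.memLp i k).toLp

lemma coeFn_lp (hz : IsStationaryGaussian P z) (i : Fin p) (k : ℤ) :
    hz.lp i k =ᵐ[P] fun ω => z k ω i :=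
  (hz.memLp i k).coeFn_toLp

lemma inner_lp_shift (hz : IsStationaryGaussian P z) (m : ℤ) (i j : Fin p) (k l : ℤ) :
    inner ℝ (hz.lp i (k + m)) (hz.lp j (l + m)) = inner ℝ (hz.lp i k) (hz.lp j l) := by
  simp only [inner_eq_integral_of_ae_eq (hz.coeFn_lp _ _) (hz.coeFn_lp _ _),
    hz.integral_mul_eq_autocorr, add_sub_add_right_eq_sub]

lemma map_eq_gaussianReal_of_mem_span (hz : IsStationaryGaussian P z) {Y : Lp ℝ 2 P}
    (hY : Y ∈ Submodule.span ℝ (Set.range fun a : Fin p × ℤ => hz.lp a.1 a.2)) :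
    P.map Y = gaussianReal 0 (‖Y‖ ^ 2).toNNReal := by
  have := hz.gaussian.isProbabilityMeasure
  obtain ⟨c, rfl⟩ := Finsupp.mem_span_range_iff_exists_finsupp.1 hY
  set Y := c.sum fun a r => r • hz.lp a.1 a.2
  have hYz : (fun ω => ∑ a ∈ c.support, c a * z a.2 ω a.1) =ᵐ[P] Y :=
    (coeFn_sum_smul c.support c fun a => hz.coeFn_lp a.1 a.2).symm
  refine map_eq_gaussianReal_zero_norm_sq
    (((hz.isGaussianProcess_coord.smul c).hasGaussianLaw_fun_sum (I := c.support)).congr hYz) ?_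
  rw [← integral_congr_ae hYz, integral_finsetSum _ fun a _ =>
    ((hz.memLp a.1 a.2).integrable (by norm_num)).const_mul (c a)]
  simp only [integral_const_mul, hz.zero_mean, mul_zero, Finset.sum_const_zero]

lemma map_eq_gaussianReal_of_mem_closure_span (hz : IsStationaryGaussian P z) {Y : Lp ℝ 2 P}
    (hY : Y ∈ (Submodule.span ℝ
      (Set.range fun a : Fin p × ℤ => hz.lp a.1 a.2)).topologicalClosure) :
    P.map Y = gaussianReal 0 (‖Y‖ ^ 2).toNNReal := by
  have := hz.gaussian.isProbabilityMeasure
  exact closure_minimal (fun Z hZ => hz.map_eq_gaussianReal_of_mem_span hZ)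
    isClosed_setOf_map_eq_gaussianReal hY

lemma exists_map_sum_eq_gaussianReal (hz : IsStationaryGaussian P z)
    (hx : ∀ i, InShiftSpan P hz.lp fun k ω => x k ω i) {α : Type*} [Fintype α] (τ : α → ℤ)
    (c : α → Fin p) (u : α → ℝ) :
    ∃ v, P.map (fun ω => ∑ a, u a * x (τ a) ω (c a)) = gaussianReal 0 v := by
  choose F hF hFx using hx
  rw [← Measure.map_congr (coeFn_sum_smul Finset.univ u fun a => hFx (c a) (τ a))]
  exact ⟨_, hz.map_eq_gaussianReal_of_mem_closure_span (Submodule.sum_mem _ fun a _ =>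
    Submodule.smul_mem _ _ (eval_mem_of_mem_shiftSpan (hF _) _))⟩

lemma isGaussianProcess_of_inShiftSpan (hz : IsStationaryGaussian P z)
    (hx : ∀ i, InShiftSpan P hz.lp fun k ω => x k ω i) : IsGaussianProcess x P := by
  classical
  refine ⟨fun I => ⟨isGaussian_of_map_eq_gaussianReal fun L => ?_⟩⟩
  have hm : AEMeasurable (fun ω => I.restrict (x · ω)) P :=
    aemeasurable_pi_lambda _ fun k => aemeasurable_pi_lambda _ fun i =>
      ((hx i).memLp k).1.aemeasurable
  obtain ⟨v, hv⟩ := hz.exists_map_sum_eq_gaussianReal hx (fun a : I × Fin p => (a.1 : ℤ))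
    Prod.snd fun a => L (Pi.single a.1 (Pi.single a.2 1))
  refine ⟨0, v, ?_⟩
  rw [AEMeasurable.map_map_of_aemeasurable (by fun_prop) hm, ← hv]
  congr 1 with ω
  have hsingle : ∀ k : I, (Pi.single k (x k ω) : I → Fin p → ℝ)
      = ∑ i, x k ω i • Pi.single k (Pi.single i 1) := fun k => by
    ext k' i'
    rcases eq_or_ne k' k with rfl | hk
    · simp [Finset.sum_apply, Pi.single_apply]
    · simp [Finset.sum_apply, hk]
  rw [Function.comp_apply, ← Finset.univ_sum_single (I.restrict (x · ω)), map_sum,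
    Fintype.sum_prod_type]
  simp only [Finset.restrict, hsingle, map_sum, map_smul, smul_eq_mul, mul_comm]

lemma of_inShiftSpan (hz : IsStationaryGaussian P z)
    (hx : ∀ i, InShiftSpan P hz.lp fun k ω => x k ω i) : IsStationaryGaussian P x where
  gaussian := hz.isGaussianProcess_of_inShiftSpan hx
  zero_mean k i := by
    obtain ⟨v, hv⟩ := hz.exists_map_sum_eq_gaussianReal hx (fun _ : Unit => k) (fun _ => i) 1
    simp only [Finset.univ_unique, Finset.sum_singleton, Pi.one_apply, one_mul] at hv
    rw [← integral_id_gaussianReal (μ := 0) (v := v), ← hv,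
      integral_map ((hx i).memLp k).1.aemeasurable (by fun_prop)]
  stationary k l i j := by
    obtain ⟨F, hF, hFx⟩ := hx i
    obtain ⟨F', hF', hFx'⟩ := hx j
    simpa only [inner_eq_integral_of_ae_eq (hFx _) (hFx' _), zero_add] using
      inner_shift_of_mem_shiftSpan (hz.inner_lp_shift l) hF hF' k 0

end IsStationaryGaussian

lemma IsAcyclic.wellFounded {G : Digraph (Fin p)} (hG : IsAcyclic G) : WellFounded G.Adj := by
  have : Std.Irrefl (Relation.TransGen G.Adj) := ⟨hG⟩
  have : IsTrans (Fin p) (Relation.TransGen G.Adj) := ⟨fun _ _ _ => Relation.TransGen.trans⟩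
  exact Subrelation.wf Relation.TransGen.single
    (Finite.wellFounded_of_trans_of_irrefl (Relation.TransGen G.Adj))

namespace IsLDS

variable {G : Digraph (Fin p)} {h : Fin p → Fin p → ℤ → ℝ} {e : ℤ → Ω → Fin p → ℝ}

lemma inShiftSpan (hx : IsLDS P G h e x) (i : Fin p) :
    InShiftSpan P hx.noise.isStationaryGaussian.lp fun k ω => x k ω i := by
  induction i using hx.acyclic.wellFounded.induction with
  | _ i ih =>
    have he : InShiftSpan P hx.noise.isStationaryGaussian.lp fun k ω => e k ω i :=
      ⟨_, mem_shiftSpan _ i, hx.noise.isStationaryGaussian.coeFn_lp i⟩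
    refine .of_tendsto (fun K => .add (.sum fun j _ => .sum fun m _ => ?_) he)
      (fun k => (hx.measurable_state k).eval.aestronglyMeasurable) (hx.dynamics · i)
    by_cases hj : G.Adj j i
    · exact ((ih j hj).shift m).const_mul _
    · have h0 : h i j = 0 := of_not_not ((hx.filter_ne_zero_iff i j).not.2 hj)
      simpa only [h0, Pi.zero_apply, zero_mul] using InShiftSpan.zero

lemma isStationaryGaussian (hx : IsLDS P G h e x) : IsStationaryGaussian P x :=
  hx.noise.isStationaryGaussian.of_inShiftSpan hx.inShiftSpan

end IsLDS

end StationaryGaussian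

section Sampling

variable {Ω Ω' : Type*} [MeasurableSpace Ω] [MeasurableSpace Ω'] {P : Measure Ω} {P' : Measure Ω'}

lemma hasGaussianLaw_of_identDistrib {E : Type*} [TopologicalSpace E] [AddCommMonoid E]
    [Module ℝ E] [MeasurableSpace E] {X : Ω → E} {Y : Ω' → E} (hX : HasGaussianLaw X P)
    (h : IdentDistrib Y X P' P) : HasGaussianLaw Y P' :=
  ⟨h.map_eq ▸ hX.isGaussian_map⟩

lemma hasGaussianLaw_comp_of_isGaussianProcess {E T α : Type*} [NormedAddCommGroup E]
    [NormedSpace ℝ E] [MeasurableSpace E] [BorelSpace E] [SecondCountableTopology E] [Finite α]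
    {X : T → Ω → E} (hX : IsGaussianProcess X P) (τ : α → T) :
    HasGaussianLaw (fun ω a => X (τ a) ω) P :=
  have := Fintype.ofFinite α
  ((hX.comp_right τ).hasGaussianLaw Finset.univ).map_fun
    (ContinuousLinearMap.pi fun a => ContinuousLinearMap.proj (R := ℝ)
      (φ := fun _ : (Finset.univ : Finset α) => E) ⟨a, Finset.mem_univ a⟩)

variable {p n N : ℕ} {x : ℤ → Ω → Fin p → ℝ} {M C ρ : ℝ}

lemma IsStationaryGaussian.variance_sum_le (hx : IsStationaryGaussian P x)
    (hR : AutocorrDecay P x C ρ)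
    (hM : ∀ θ ∈ Set.Icc 0 (2 * Real.pi), ∀ μ ∈ spectrum ℝ (psdm P x θ), μ ≤ M)
    {α : Type*} [Fintype α] {τ : α → ℤ} {c : α → Fin p}
    (hinj : Function.Injective fun a => (τ a, c a)) (u : α → ℝ) :
    Var[fun ω => ∑ a, u a * x (τ a) ω (c a); P] ≤ M * ∑ a, u a ^ 2 := by
  have := hx.gaussian.isProbabilityMeasure
  have hcov : ∀ a b, cov[fun ω => u a * x (τ a) ω (c a), fun ω => u b * x (τ b) ω (c b); P]
      = u a * u b * autocorr P x (τ a - τ b) (c a) (c b) := fun a b => by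
    rw [covariance_const_mul_left, covariance_const_mul_right,
      covariance_eq_sub (hx.memLp _ _) (hx.memLp _ _), hx.zero_mean, zero_mul, sub_zero,
      ← hx.integral_mul_eq_autocorr, mul_assoc]
    rfl
  rw [variance_fun_sum fun a => (hx.memLp (c a) (τ a)).const_mul (u a)]
  simp only [hcov]
  exact sum_autocorr_le hR hx.autocorr_neg hM hinj u

/-- The properties shared by both sampling schemes that the concentration argument uses: the
recorded trajectories are centred and jointly Gaussian, each of them has the autocorrelation of
`x`, and the joint covariance matrix of all samples is bounded by `M`. -/
structure IsGaussianSample (P : Measure Ω) (x : ℤ → Ω → Fin p → ℝ) (M : ℝ) (P' : Measure Ω')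
    (y : Fin n → Ω' → Fin N → Fin p → ℝ) : Prop where
  hasGaussianLaw : HasGaussianLaw (fun ω r => y r ω) P'
  integral_eq_zero : ∀ r t i, ∫ ω, y r ω t i ∂P' = 0
  integral_mul : ∀ r (s t : Fin N) i j,
    ∫ ω, y r ω s i * y r ω t j ∂P' = autocorr P x ((s : ℤ) - (t : ℤ)) i j
  variance_le : ∀ u : Fin n → Fin N × Fin p → ℝ,
    Var[fun ω => ∑ r, ∑ b, u r b * y r ω b.1 b.2; P'] ≤ M * ∑ r, ∑ b, u r b ^ 2

lemma injective_segment_time :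
    Function.Injective fun a : Fin n × Fin N × Fin p => ((a.1 : ℤ) * N + (a.2.1 : ℕ), a.2.2) := by
  rintro ⟨r, t, i⟩ ⟨r', t', i'⟩ h
  obtain ⟨htime, rfl⟩ := Prod.mk.inj h
  have htime' : (r : ℕ) * N + t = r' * N + t' := by exact_mod_cast htime
  have hrt : finProdFinEquiv (r, t) = finProdFinEquiv (r', t') := Fin.ext <| by
    simpa [finProdFinEquiv, mul_comm, add_comm] using htime'
  obtain ⟨rfl, rfl⟩ := Prod.mk.inj (finProdFinEquiv.injective hrt)
  rfl

variable {y : Fin n → Ω' → Fin N → Fin p → ℝ}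

lemma ContinuousSampling.isGaussianSample (hx : IsStationaryGaussian P x)
    (hR : AutocorrDecay P x C ρ)
    (hM : ∀ θ ∈ Set.Icc 0 (2 * Real.pi), ∀ μ ∈ spectrum ℝ (psdm P x θ), μ ≤ M)
    (hy : ContinuousSampling P x P' y) : IsGaussianSample P x M P' y where
  hasGaussianLaw := by
    refine hasGaussianLaw_of_identDistrib ?_ hy
    exact (hasGaussianLaw_comp_of_isGaussianProcess hx.gaussian
      fun a : Fin n × Fin N => (a.1 : ℤ) * N + (a.2 : ℕ)).map_fun
        (ContinuousLinearMap.pi fun r => ContinuousLinearMap.pi fun t =>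
          ContinuousLinearMap.proj (R := ℝ) (φ := fun _ : Fin n × Fin N => Fin p → ℝ) (r, t))
  integral_eq_zero r t i := by
    have hlaw := IdentDistrib.comp hy (u := fun z : Fin n → Fin N → Fin p → ℝ => z r t i)
      (by fun_prop)
    exact hlaw.integral_eq.trans (hx.zero_mean _ _)
  integral_mul r s t i j := by
    have hlaw := IdentDistrib.comp hy
      (u := fun z : Fin n → Fin N → Fin p → ℝ => z r s i * z r t j) (by fun_prop)
    have hstat := hx.integral_mul_eq_autocorr i j ((r : ℤ) * N + s) ((r : ℤ) * N + t)
    rw [add_sub_add_left_eq_sub] at hstat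
    exact hlaw.integral_eq.trans hstat
  variance_le u := by
    have hlaw := IdentDistrib.comp hy (u := fun z : Fin n → Fin N → Fin p → ℝ =>
      ∑ r, ∑ b : Fin N × Fin p, u r b * z r b.1 b.2) (by fun_prop)
    have hvar := hx.variance_sum_le hR hM injective_segment_time
      fun a : Fin n × Fin N × Fin p => u a.1 a.2
    rw [Fintype.sum_prod_type (f := fun a => u a.1 a.2 ^ 2)] at hvar
    simp only [Fintype.sum_prod_type (α₁ := Fin n)] at hvar
    exact hlaw.variance_eq.trans_le hvar

lemma RestartAndRecord.isGaussianSample (hx : IsStationaryGaussian P x)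
    (hR : AutocorrDecay P x C ρ)
    (hM : ∀ θ ∈ Set.Icc 0 (2 * Real.pi), ∀ μ ∈ spectrum ℝ (psdm P x θ), μ ≤ M)
    (hy : RestartAndRecord P x P' y) : IsGaussianSample P x M P' y := by
  have hG : ∀ r, HasGaussianLaw (y r) P' := fun r => hasGaussianLaw_of_identDistrib
    (hasGaussianLaw_comp_of_isGaussianProcess hx.gaussian fun t : Fin N => ((t : ℕ) : ℤ)) (hy.law r)
  have hvar : ∀ r (u : Fin N × Fin p → ℝ),
      Var[fun ω => ∑ b, u b * y r ω b.1 b.2; P'] ≤ M * ∑ b, u b ^ 2 := fun r u => by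
    have hlaw := (hy.law r).comp
      (u := fun z : Fin N → Fin p → ℝ => ∑ b : Fin N × Fin p, u b * z b.1 b.2) (by fun_prop)
    have hinj : Function.Injective fun b : Fin N × Fin p => (((b.1 : ℕ) : ℤ), b.2) := by
      rintro ⟨t, i⟩ ⟨t', i'⟩ h
      simpa [Fin.ext_iff] using h
    exact hlaw.variance_eq.trans_le (hx.variance_sum_le hR hM hinj u)
  have hmem : ∀ r (b : Fin N × Fin p), MemLp (fun ω => y r ω b.1 b.2) 2 P' := fun r b =>
    ((hG r).memLp_two.eval b.1).eval b.2
  refine ⟨hy.indep.hasGaussianLaw hG, fun r t i => ?_, fun r s t i j => ?_, fun u => ?_⟩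
  · have hlaw := (hy.law r).comp (u := fun z : Fin N → Fin p → ℝ => z t i) (by fun_prop)
    exact hlaw.integral_eq.trans (hx.zero_mean _ _)
  · have hlaw := (hy.law r).comp (u := fun z : Fin N → Fin p → ℝ => z s i * z t j) (by fun_prop)
    exact hlaw.integral_eq.trans (hx.integral_mul_eq_autocorr _ _ _ _)
  · have hind : iIndepFun (fun r ω => ∑ b : Fin N × Fin p, u r b * y r ω b.1 b.2) P' :=
      hy.indep.comp (fun r z => ∑ b : Fin N × Fin p, u r b * z b.1 b.2) fun r => by fun_prop
    have hsum := IndepFun.variance_sum (s := Finset.univ)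
      (fun r _ => memLp_finsetSum _ fun b _ => (hmem r b).const_mul (u r b))
      (fun r _ s _ hrs => hind.indepFun hrs)
    rw [Finset.mul_sum]
    refine (Eq.trans_le ?_ (Finset.sum_le_sum fun r _ => hvar r (u r)))
    rw [← hsum, Finset.sum_fn]

end Sampling

section WeightedSums

variable {Ω Ω' : Type*} [MeasurableSpace Ω] [MeasurableSpace Ω'] {P : Measure Ω} {P' : Measure Ω'}
  {p n N : ℕ} {x : ℤ → Ω → Fin p → ℝ} {M : ℝ} {y : Fin n → Ω' → Fin N → Fin p → ℝ}

/-- The map sending `n` trajectories to the vector of their `n` linear combinations with the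
complex weights `w`. -/
noncomputable def weightedSums (n : ℕ) (w : Fin N × Fin p → ℂ) :
    (Fin n → Fin N → Fin p → ℝ) →L[ℝ] EuclideanSpace ℂ (Fin n) :=
  LinearMap.toContinuousLinearMap
    { toFun := fun z => WithLp.toLp 2 fun r => ∑ b, w b * z r b.1 b.2
      map_add' := fun z z' => by
        ext r
        simp [mul_add, Finset.sum_add_distrib]
      map_smul' := fun c z => by
        ext r
        simp [Finset.mul_sum, mul_left_comm] }

lemma weightedSums_apply (w : Fin N × Fin p → ℂ) (z : Fin n → Fin N → Fin p → ℝ) (r : Fin n) :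
    weightedSums n w z r = ∑ b, w b * z r b.1 b.2 := rfl

open scoped RealInnerProductSpace in
lemma inner_weightedSums (w : Fin N × Fin p → ℂ) (u : EuclideanSpace ℂ (Fin n))
    (z : Fin n → Fin N → Fin p → ℝ) :
    ⟪u, weightedSums n w z⟫ = ∑ r, ∑ b, (star (u r) * w b).re * z r b.1 b.2 := by
  simp only [PiLp.inner_apply, Complex.inner, mul_comm _ (starRingEnd ℂ _), weightedSums_apply,
    Finset.mul_sum, Complex.re_sum, ← mul_assoc, Complex.re_mul_ofReal, Complex.star_def]

namespace IsGaussianSample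

lemma memLp (hy : IsGaussianSample P x M P' y) (r : Fin n) (t : Fin N) (i : Fin p) :
    MemLp (fun ω => y r ω t i) 2 P' :=
  ((hy.hasGaussianLaw.memLp_two.eval r).eval t).eval i

lemma hasGaussianLaw_weightedSums (hy : IsGaussianSample P x M P' y) (w : Fin N × Fin p → ℂ) :
    HasGaussianLaw (fun ω => weightedSums n w fun r => y r ω) P' :=
  hy.hasGaussianLaw.map_fun (weightedSums n w)

lemma integral_weightedSums (hy : IsGaussianSample P x M P' y) (w : Fin N × Fin p → ℂ) :
    ∫ ω, weightedSums n w (fun r => y r ω) ∂P' = 0 := by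
  have hint := hy.hasGaussianLaw.integrable
  have hmean : ∫ ω, (fun r => y r ω) ∂P' = 0 := by
    ext r t i
    rw [eval_integral hint.eval, eval_integral (hint.eval r).eval,
      eval_integral ((hint.eval r).eval t).eval]
    exact hy.integral_eq_zero r t i
  rw [ContinuousLinearMap.integral_comp_comm _ hint, hmean, map_zero]

open scoped RealInnerProductSpace in
lemma variance_inner_weightedSums_le (hy : IsGaussianSample P x M P' y) (hM : 0 ≤ M)
    (w : Fin N × Fin p → ℂ) (u : EuclideanSpace ℂ (Fin n)) :
    Var[fun ω => ⟪u, weightedSums n w fun r => y r ω⟫; P']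
      ≤ M * (∑ b, ‖w b‖ ^ 2) * ‖u‖ ^ 2 := by
  simp only [inner_weightedSums]
  refine (hy.variance_le fun r b => (star (u r) * w b).re).trans ?_
  rw [mul_assoc]
  gcongr
  calc ∑ r, ∑ b, (star (u r) * w b).re ^ 2
      ≤ ∑ r, ∑ b, ‖u r‖ ^ 2 * ‖w b‖ ^ 2 := by
        gcongr with r _ b
        rw [← mul_pow, ← norm_star, ← norm_mul]
        exact sq_le_sq.2 ((Complex.abs_re_le_norm _).trans_eq (abs_norm _).symm)
    _ = (∑ b, ‖w b‖ ^ 2) * ‖u‖ ^ 2 := by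
        simp only [EuclideanSpace.norm_sq_eq, ← Finset.mul_sum, ← Finset.sum_mul]
        ring

lemma integral_sum_mul_sq_le (hy : IsGaussianSample P x M P' y) (u : Fin N × Fin p → ℝ)
    (r : Fin n) : ∫ ω, (∑ b, u b * y r ω b.1 b.2) ^ 2 ∂P' ≤ M * ∑ b, u b ^ 2 := by
  have hmem : ∀ b : Fin N × Fin p, MemLp (fun ω => u b * y r ω b.1 b.2) 2 P' := fun b =>
    (hy.memLp r b.1 b.2).const_mul _
  have := hy.hasGaussianLaw.isProbabilityMeasure
  have hmean : ∫ ω, ∑ b, u b * y r ω b.1 b.2 ∂P' = 0 := by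
    rw [integral_finsetSum _ fun b _ => (hmem b).integrable (by norm_num)]
    simp [integral_const_mul, hy.integral_eq_zero]
  have hvar := hy.variance_le fun r' b => if r' = r then u b else 0
  simp only [ite_mul, zero_mul, ite_pow, zero_pow two_ne_zero, Finset.sum_comm (s := Finset.univ)
    (t := (Finset.univ : Finset (Fin N × Fin p))), Finset.sum_ite_eq', Finset.mem_univ, if_true]
    at hvar
  rwa [variance_of_integral_eq_zero
    (memLp_finsetSum _ fun b _ => hmem b).1.aemeasurable hmean] at hvar

lemma integral_norm_sq_sum_le (hy : IsGaussianSample P x M P' y) (w : Fin N × Fin p → ℂ)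
    (r : Fin n) : ∫ ω, ‖∑ b, w b * y r ω b.1 b.2‖ ^ 2 ∂P' ≤ M * ∑ b, ‖w b‖ ^ 2 := by
  have hsq : ∀ u : Fin N × Fin p → ℝ,
      Integrable (fun ω => (∑ b, u b * y r ω b.1 b.2) ^ 2) P' := fun u =>
    (memLp_finsetSum _ fun b _ => (hy.memLp r b.1 b.2).const_mul (u b)).integrable_sq
  have hsplit : ∀ ω, ‖∑ b, w b * y r ω b.1 b.2‖ ^ 2
      = (∑ b, (w b).re * y r ω b.1 b.2) ^ 2 + (∑ b, (w b).im * y r ω b.1 b.2) ^ 2 := fun ω => by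
    simp [Complex.sq_norm, Complex.normSq_apply, ← sq]
  simp only [hsplit]
  calc _ = _ := integral_add (hsq _) (hsq _)
    _ ≤ M * ∑ b, (w b).re ^ 2 + M * ∑ b, (w b).im ^ 2 :=
      add_le_add (hy.integral_sum_mul_sq_le _ r) (hy.integral_sum_mul_sq_le _ r)
    _ = M * ∑ b, ‖w b‖ ^ 2 := by
      simp only [Complex.sq_norm, Complex.normSq_apply, ← mul_add, ← Finset.sum_add_distrib, ← sq]

lemma integral_norm_sq_weightedSums (hy : IsGaussianSample P x M P' y) (w : Fin N × Fin p → ℂ) :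
    ∫ ω, ‖weightedSums n w fun r => y r ω‖ ^ 2 ∂P'
      = ∑ r, ∫ ω, ‖∑ b, w b * y r ω b.1 b.2‖ ^ 2 ∂P' := by
  simp only [EuclideanSpace.norm_sq_eq, weightedSums_apply]
  refine integral_finsetSum _ fun r _ => MemLp.integrable_norm_pow ?_ two_ne_zero
  exact memLp_finsetSum _ fun b _ => (hy.memLp r b.1 b.2).ofReal.const_mul (w b)

lemma measureReal_abs_norm_sq_weightedSums_sub_ge_le (hy : IsGaussianSample P x M P' y)
    (hM : 0 < M) (hn : n ≠ 0) {w : Fin N × Fin p → ℂ} (hw : ∑ b, ‖w b‖ ^ 2 = 1) {t : ℝ}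
    (ht : 0 ≤ t) (htM : t ≤ 6 * n * M) :
    P'.real {ω | t ≤ |‖weightedSums n w fun r => y r ω‖ ^ 2
        - ∫ ω, ‖weightedSums n w fun r => y r ω‖ ^ 2 ∂P'|}
      ≤ 2 * Real.exp (-(t ^ 2 / (32 * n * M ^ 2))) := by
  refine measureReal_abs_norm_sq_sub_ge_le (hy.hasGaussianLaw_weightedSums w)
    (hy.integral_weightedSums w) hM (by positivity) (fun u => ?_) ?_ ht htM
  · simpa [hw] using hy.variance_inner_weightedSums_le hM.le w u
  · rw [hy.integral_norm_sq_weightedSums w]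
    refine (Finset.sum_le_sum fun r _ => hy.integral_norm_sq_sum_le w r).trans_eq ?_
    simp [hw]

lemma ofReal_integral_norm_sq_sum (hy : IsGaussianSample P x M P' y) (w : Fin N × Fin p → ℂ)
    (r : Fin n) :
    ((∫ ω, ‖∑ b, w b * y r ω b.1 b.2‖ ^ 2 ∂P' : ℝ) : ℂ)
      = ∑ a, ∑ b, w a * star (w b) * autocorr P x ((a.1 : ℤ) - (b.1 : ℤ)) a.2 b.2 := by
  have hexpand : ∀ ω, ((‖∑ b, w b * y r ω b.1 b.2‖ ^ 2 : ℝ) : ℂ)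
      = ∑ a, ∑ b, w a * star (w b) * ((y r ω a.1 a.2 * y r ω b.1 b.2 : ℝ) : ℂ) := fun ω => by
    rw [Complex.ofReal_pow, ← Complex.mul_conj', map_sum, Finset.sum_mul_sum]
    refine Finset.sum_congr rfl fun a _ => Finset.sum_congr rfl fun b _ => ?_
    rw [map_mul, Complex.conj_ofReal, Complex.star_def, Complex.ofReal_mul]
    ring
  have hint : ∀ a b : Fin N × Fin p, Integrable (fun ω =>
      w a * star (w b) * ((y r ω a.1 a.2 * y r ω b.1 b.2 : ℝ) : ℂ)) P' := fun a b =>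
    ((hy.memLp r a.1 a.2).integrable_mul (hy.memLp r b.1 b.2)).ofReal.const_mul _
  rw [← integral_complex_ofReal]
  simp_rw [hexpand]
  rw [integral_finsetSum _ fun a _ => integrable_finsetSum _ fun b _ => hint a b]
  refine Finset.sum_congr rfl fun a _ => ?_
  rw [integral_finsetSum _ fun b _ => hint a b]
  refine Finset.sum_congr rfl fun b _ => ?_
  rw [integral_const_mul, integral_complex_ofReal, hy.integral_mul]

end IsGaussianSample

end WeightedSums

section QuadraticFormOfEstimator

variable {p n N : ℕ}

/-- The weights of the samples `y t i` in the linear combination `v^* x(θ)` of the coordinates of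
the normalized Fourier transform `x(θ)` of the trajectory `y`. -/
noncomputable def dftWeight (N : ℕ) (θ : ℝ) (v : Fin p → ℂ) (b : Fin N × Fin p) : ℂ :=
  star (v b.2) * ((1 / (Real.sqrt N : ℂ)) * Complex.exp (-(Complex.I * θ * ((b.1 : ℕ) : ℂ))))

lemma star_dotProduct_dft (v : Fin p → ℂ) (θ : ℝ) (z : Fin N → Fin p → ℝ) :
    star v ⬝ᵥ dft z θ = ∑ b, dftWeight N θ v b * z b.1 b.2 := by
  simp only [dotProduct, dft, Finset.mul_sum, Fintype.sum_prod_type, dftWeight, Pi.star_apply]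
  rw [Finset.sum_comm]
  refine Finset.sum_congr rfl fun t _ => Finset.sum_congr rfl fun i _ => ?_
  ring

lemma sum_norm_sq_dftWeight (hN : N ≠ 0) (θ : ℝ) (v : EuclideanSpace ℂ (Fin p)) :
    ∑ b, ‖dftWeight N θ v b‖ ^ 2 = ‖v‖ ^ 2 := by
  have hweight : ∀ b : Fin N × Fin p,
      ‖dftWeight N θ v b‖ ^ 2 = 1 / (N : ℝ) * ‖v b.2‖ ^ 2 := fun b => by
    have hexp := norm_exp_neg_I_mul θ (b.1 : ℤ)
    rw [Int.cast_natCast] at hexp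
    rw [dftWeight, norm_mul, norm_mul, hexp, norm_star, mul_one, mul_pow, norm_div, norm_one,
      Complex.norm_real, Real.norm_of_nonneg (Real.sqrt_nonneg _), div_pow,
      Real.sq_sqrt N.cast_nonneg, one_pow, mul_comm]
  have hN' : (N : ℝ) ≠ 0 := by exact_mod_cast hN
  simp_rw [hweight, Fintype.sum_prod_type, EuclideanSpace.norm_sq_eq, ← Finset.mul_sum]
  simp [hN']

lemma dftWeight_mul_star (θ : ℝ) (v : Fin p → ℂ) (a b : Fin N × Fin p) :
    dftWeight N θ v a * star (dftWeight N θ v b) = (1 / (N : ℂ)) * (star (v a.2) *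
      (Complex.exp (-(Complex.I * θ * (((a.1 : ℤ) - (b.1 : ℤ) : ℤ) : ℂ))) * v b.2)) := by
  have hstar : star (Complex.exp (-(Complex.I * θ * ((b.1 : ℕ) : ℂ))))
      = Complex.exp (Complex.I * θ * ((b.1 : ℕ) : ℂ)) := by
    simp [← Complex.exp_conj]
  have hsqrt : (1 / (Real.sqrt N : ℂ)) * star (1 / (Real.sqrt N : ℂ)) = 1 / (N : ℂ) := by
    rw [Complex.star_def, map_div₀, map_one, Complex.conj_ofReal, div_mul_div_comm, one_mul,
      ← Complex.ofReal_mul, Real.mul_self_sqrt N.cast_nonneg, Complex.ofReal_natCast]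
  have hexp : Complex.exp (-(Complex.I * θ * (((a.1 : ℤ) - (b.1 : ℤ) : ℤ) : ℂ)))
      = Complex.exp (-(Complex.I * θ * ((a.1 : ℕ) : ℂ)))
        * Complex.exp (Complex.I * θ * ((b.1 : ℕ) : ℂ)) := by
    rw [← Complex.exp_add]
    congr 1
    push_cast
    ring
  rw [dftWeight, dftWeight, star_mul', star_mul', star_star, hstar, hexp, ← hsqrt]
  ring

lemma fejerMean_apply (D : ℤ → Matrix (Fin p) (Fin p) ℝ) (N : ℕ) (θ : ℝ) (i j : Fin p) :
    fejerMean D N θ i j = (1 / (N : ℂ)) * ∑ s : Fin N, ∑ t : Fin N,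
      Complex.exp (-(Complex.I * θ * (((s : ℤ) - (t : ℤ) : ℤ) : ℂ)))
        * D ((s : ℤ) - (t : ℤ)) i j := by
  rw [fejerMean, Finset.sum_comm, Finset.sum_range]
  simp_rw [Finset.sum_range]
  simp [Matrix.sum_apply, symbolTerm]

lemma star_dotProduct_fejerMean_mulVec (D : ℤ → Matrix (Fin p) (Fin p) ℝ) (v : Fin p → ℂ) (θ : ℝ) :
    star v ⬝ᵥ (fejerMean D N θ).mulVec v = ∑ a, ∑ b, dftWeight N θ v a
      * star (dftWeight N θ v b) * D ((a.1 : ℤ) - (b.1 : ℤ)) a.2 b.2 := by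
  simp only [dftWeight_mul_star, dotProduct, Matrix.mulVec, fejerMean_apply,
    Fintype.sum_prod_type, Finset.mul_sum, Finset.sum_mul, Pi.star_apply]
  conv_rhs => rw [Finset.sum_comm]
  refine Finset.sum_congr rfl fun i _ => ?_
  rw [Finset.sum_comm]
  refine Finset.sum_congr rfl fun s _ => ?_
  rw [Finset.sum_comm]
  refine Finset.sum_congr rfl fun t _ => Finset.sum_congr rfl fun j _ => ?_
  ring

lemma star_dotProduct_psdmEstimator_mulVec (v : Fin p → ℂ) (θ : ℝ)
    (z : Fin n → Fin N → Fin p → ℝ) :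
    star v ⬝ᵥ (psdmEstimator z θ).mulVec v
      = ((1 / (n : ℝ) * ‖weightedSums n (dftWeight N θ v) z‖ ^ 2 : ℝ) : ℂ) := by
  rw [psdmEstimator, Matrix.smul_mulVec, dotProduct_smul, Matrix.sum_mulVec, dotProduct_sum,
    EuclideanSpace.norm_sq_eq]
  simp only [weightedSums_apply, ← star_dotProduct_dft]
  push_cast
  rw [smul_eq_mul]
  congr! 2 with r
  rw [Matrix.vecMulVec_mulVec, dotProduct_smul, op_smul_eq_mul,
    Matrix.star_dotProduct (dft (z r) θ) v, ← Complex.mul_conj', Complex.star_def]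

lemma isHermitian_psdmEstimator (z : Fin n → Fin N → Fin p → ℝ) (θ : ℝ) :
    (psdmEstimator z θ).IsHermitian := by
  rw [Matrix.IsHermitian, psdmEstimator, Matrix.conjTranspose_smul, Matrix.conjTranspose_sum]
  simp [Matrix.conjTranspose_vecMulVec]

end QuadraticFormOfEstimator

section EstimatorConcentration

variable {Ω Ω' : Type*} [MeasurableSpace Ω] [MeasurableSpace Ω'] {P : Measure Ω} {P' : Measure Ω'}
  {p n N : ℕ} {x : ℤ → Ω → Fin p → ℝ} {M : ℝ} {y : Fin n → Ω' → Fin N → Fin p → ℝ}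

lemma two_mul_pow_le_exp (hp : p ≠ 0) : 2 * (25 : ℝ) ^ p ≤ Real.exp (6 * p) := by
  have hfifty : (50 : ℝ) ≤ Real.exp 6 := calc
    (50 : ℝ) ≤ 2 ^ 6 := by norm_num
    _ ≤ Real.exp 1 ^ 6 := by
      gcongr
      linarith [Real.exp_one_gt_d9]
    _ = Real.exp 6 := by
      rw [← Real.exp_nat_mul]
      norm_num
  calc 2 * (25 : ℝ) ^ p ≤ 2 ^ p * 25 ^ p := by
        gcongr
        exact le_self_pow₀ (by norm_num) hp
    _ = 50 ^ p := by
        rw [← mul_pow]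
        norm_num
    _ ≤ Real.exp 6 ^ p := by gcongr
    _ = Real.exp (6 * p) := by rw [← Real.exp_nat_mul, mul_comm]

namespace IsGaussianSample

lemma star_dotProduct_psdmEstimator_sub_fejerMean_mulVec (hy : IsGaussianSample P x M P' y)
    (hn : n ≠ 0) (θ : ℝ) (v : Fin p → ℂ) (ω : Ω') :
    star v ⬝ᵥ (psdmEstimator (fun r => y r ω) θ - fejerMean (autocorr P x) N θ).mulVec v
      = ((1 / (n : ℝ) * (‖weightedSums n (dftWeight N θ v) fun r => y r ω‖ ^ 2
        - ∫ ω, ‖weightedSums n (dftWeight N θ v) fun r => y r ω‖ ^ 2 ∂P') : ℝ) : ℂ) := by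
  have hmean : star v ⬝ᵥ (fejerMean (autocorr P x) N θ).mulVec v = ((1 / (n : ℝ)
      * ∫ ω, ‖weightedSums n (dftWeight N θ v) fun r => y r ω‖ ^ 2 ∂P' : ℝ) : ℂ) := by
    rw [hy.integral_norm_sq_weightedSums, Complex.ofReal_mul, Complex.ofReal_sum]
    simp only [hy.ofReal_integral_norm_sq_sum, ← star_dotProduct_fejerMean_mulVec]
    simp [hn]
  rw [Matrix.sub_mulVec, dotProduct_sub, star_dotProduct_psdmEstimator_mulVec, hmean, mul_sub,
    Complex.ofReal_sub]

lemma measureReal_norm_star_dotProduct_psdmEstimator_sub_fejerMean_ge_le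
    (hy : IsGaussianSample P x M P' y) (hM : 0 < M) (hn : n ≠ 0) (hN : N ≠ 0) (θ : ℝ)
    {v : EuclideanSpace ℂ (Fin p)} (hv : ‖v‖ = 1) {t : ℝ} (ht : 0 ≤ t) (htM : t ≤ 6 * M) :
    P'.real {ω | t ≤ ‖star v.ofLp ⬝ᵥ
        (psdmEstimator (fun r => y r ω) θ - fejerMean (autocorr P x) N θ).mulVec v.ofLp‖}
      ≤ 2 * Real.exp (-(t ^ 2 * n / (32 * M ^ 2))) := by
  have hn' : (0 : ℝ) < n := by positivity
  have hw : ∑ b, ‖dftWeight N θ v b‖ ^ 2 = 1 := by rw [sum_norm_sq_dftWeight hN, hv, one_pow]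
  have htail := hy.measureReal_abs_norm_sq_weightedSums_sub_ge_le hM hn hw (t := n * t)
    (by positivity) (by nlinarith)
  simp only [hy.star_dotProduct_psdmEstimator_sub_fejerMean_mulVec hn, Complex.norm_real,
    Real.norm_eq_abs, one_div_mul_eq_div, abs_div, abs_of_pos hn',
    le_div_iff₀' hn']
  refine htail.trans_eq ?_
  congr 3
  field_simp

lemma measureReal_norm_psdmEstimator_sub_fejerMean_ge_le_card_mul
    (hy : IsGaussianSample P x M P' y) (hR : ∀ k, autocorr P x (-k) = (autocorr P x k).transpose)
    (hM : 0 < M) (hp : p ≠ 0) (hn : n ≠ 0) (hN : N ≠ 0) (θ : ℝ) {δ : ℝ} (hδ : 0 ≤ δ)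
    (hδM : δ ≤ 12 * M) {s : Finset (EuclideanSpace ℂ (Fin p))}
    (hs : (s : Set (EuclideanSpace ℂ (Fin p))) ⊆ Metric.sphere 0 1)
    (hcover : Metric.IsCover (1 / 2) (Metric.sphere 0 1) (s : Set (EuclideanSpace ℂ (Fin p)))) :
    P'.real {ω | δ ≤ ‖psdmEstimator (fun r => y r ω) θ - fejerMean (autocorr P x) N θ‖}
      ≤ s.card * (2 * Real.exp (-(δ ^ 2 * n / (128 * M ^ 2)))) := by
  have := hy.hasGaussianLaw.isProbabilityMeasure
  have : Nonempty (Fin p) := ⟨⟨0, Nat.pos_of_ne_zero hp⟩⟩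
  have hsub : {ω | δ ≤ ‖psdmEstimator (fun r => y r ω) θ - fejerMean (autocorr P x) N θ‖}
      ⊆ ⋃ v ∈ s, {ω | δ / 2 ≤ ‖star v.ofLp ⬝ᵥ
        (psdmEstimator (fun r => y r ω) θ - fejerMean (autocorr P x) N θ).mulVec v.ofLp‖} := by
    intro ω hω
    rw [Set.mem_ofPred_eq] at hω
    obtain ⟨v, hv, hle⟩ := exists_norm_le_two_mul_norm_star_dotProduct
      ((isHermitian_psdmEstimator (fun r => y r ω) θ).sub (isHermitian_fejerMean hR N θ)) hs hcover
    refine Set.mem_biUnion hv ?_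
    rw [Set.mem_ofPred_eq]
    linarith
  have htail : ∀ v ∈ s, P'.real {ω | δ / 2 ≤ ‖star v.ofLp ⬝ᵥ
        (psdmEstimator (fun r => y r ω) θ - fejerMean (autocorr P x) N θ).mulVec v.ofLp‖}
      ≤ 2 * Real.exp (-(δ ^ 2 * n / (128 * M ^ 2))) := fun v hv => by
    refine (hy.measureReal_norm_star_dotProduct_psdmEstimator_sub_fejerMean_ge_le hM hn hN θ
      (mem_sphere_zero_iff_norm.1 (hs hv)) (by positivity) (by linarith)).trans_eq ?_
    congr 3
    ring
  calc _ ≤ _ := measureReal_mono hsub (measure_ne_top _ _)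
    _ ≤ _ := measureReal_biUnion_finset_le _ _
    _ ≤ _ := Finset.sum_le_card_nsmul _ _ _ htail
    _ = _ := nsmul_eq_mul _ _

lemma measureReal_norm_psdmEstimator_sub_fejerMean_ge_le (hy : IsGaussianSample P x M P' y)
    (hR : ∀ k, autocorr P x (-k) = (autocorr P x k).transpose) (hM : 0 < M) (hN : N ≠ 0) (θ : ℝ)
    {δ : ℝ} (hδ : 0 < δ) (hδM : δ ≤ 12 * M) :
    P'.real {ω | δ ≤ ‖psdmEstimator (fun r => y r ω) θ - fejerMean (autocorr P x) N θ‖}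
      ≤ Real.exp (-(δ ^ 2 * n / (128 * M ^ 2)) + 6 * p) := by
  have := hy.hasGaussianLaw.isProbabilityMeasure
  rcases eq_or_ne p 0 with rfl | hp
  · have hempty : {ω | δ ≤ ‖psdmEstimator (fun r => y r ω) θ - fejerMean (autocorr P x) N θ‖}
        = ∅ := Set.eq_empty_of_forall_notMem fun ω hω => by
      rw [Set.mem_ofPred_eq, Subsingleton.elim (psdmEstimator _ θ - _) 0, norm_zero] at hω
      exact hδ.not_ge hω
    rw [hempty, measureReal_empty]
    positivity
  rcases eq_or_ne n 0 with rfl | hn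
  · exact measureReal_le_one.trans (Real.one_le_exp (by simp))
  obtain ⟨s, hcard, hs, hcover⟩ := exists_finset_isCover_sphere (EuclideanSpace ℂ (Fin p))
  have hcard' : (s.card : ℝ) ≤ 25 ^ p := by
    rw [finrank_real_of_complex, finrank_euclideanSpace_fin, pow_mul] at hcard
    exact_mod_cast hcard
  calc _ ≤ s.card * (2 * Real.exp (-(δ ^ 2 * n / (128 * M ^ 2)))) :=
        hy.measureReal_norm_psdmEstimator_sub_fejerMean_ge_le_card_mul hR hM hp hn hN θ hδ.le hδM
          hs hcover
    _ ≤ 2 * 25 ^ p * Real.exp (-(δ ^ 2 * n / (128 * M ^ 2))) := by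
        rw [← mul_assoc, mul_comm (s.card : ℝ) 2]
        gcongr
    _ ≤ Real.exp (6 * p) * Real.exp (-(δ ^ 2 * n / (128 * M ^ 2))) := by
        gcongr
        exact two_mul_pow_le_exp hp
    _ = _ := by rw [← Real.exp_add, add_comm]

end IsGaussianSample

end EstimatorConcentration

end DDAG

theorem corollary4p3_general {Ω Ω' : Type*} [MeasurableSpace Ω] [MeasurableSpace Ω']
    {P : Measure Ω} {P' : Measure Ω'} {p n N : ℕ} {x : ℤ → Ω → Fin p → ℝ}
    (hx : DDAG.IsStationaryGaussian P x) {M C ρ : ℝ}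
    (hM : ∀ θ ∈ Set.Icc 0 (2 * Real.pi), ∀ μ ∈ spectrum ℝ (DDAG.psdm P x θ), μ ≤ M)
    (hR : DDAG.AutocorrDecay P x C ρ) {y : Fin n → Ω' → Fin N → Fin p → ℝ}
    (hy : DDAG.RestartAndRecord P x P' y ∨ DDAG.ContinuousSampling P x P' y)
    {ε₁ ε₂ : ℝ} (hε₁ : 0 < ε₁) (hε₂ : 0 < ε₂) (hε₂M : ε₂ ≤ 12 * M)
    (hN : 2 * C * ρ⁻¹ / ((1 - ρ⁻¹) ^ 2 * ε₁) < (N : ℝ)) (θ : ℝ) :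
    P'.real {ω | ε₁ + ε₂ ≤ ‖DDAG.psdm P x θ - DDAG.psdmEstimator (fun r => y r ω) θ‖}
      ≤ Real.exp (-(ε₂ ^ 2 * n / (128 * M ^ 2)) + 6 * p) := by
  have hy' : DDAG.IsGaussianSample P x M P' y :=
    hy.elim (fun h => h.isGaussianSample hx hR hM) (fun h => h.isGaussianSample hx hR hM)
  have := hy'.hasGaussianLaw.isProbabilityMeasure
  have hbias := hR.norm_psdm_sub_fejerMean_lt hε₁ hN θ
  refine (measureReal_mono (fun ω hω => ?_)).trans
    (hy'.measureReal_norm_psdmEstimator_sub_fejerMean_ge_le hx.autocorr_neg (by linarith)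
      (hR.ne_zero_of_lt hε₁ hN) θ hε₂ hε₂M)
  rw [Set.mem_ofPred_eq] at hω ⊢
  rw [norm_sub_rev]
  have htri := norm_sub_le_norm_sub_add_norm_sub (DDAG.psdm P x θ)
    (DDAG.fejerMean (DDAG.autocorr P x) N θ) (DDAG.psdmEstimator (fun r => y r ω) θ)
  linarith

theorem corollary4p3 {Ω Ω' : Type*} [MeasurableSpace Ω] [MeasurableSpace Ω']
    (P : Measure Ω) [IsProbabilityMeasure P] (P' : Measure Ω') [IsProbabilityMeasure P']
    {p n N : ℕ} (G : Digraph (Fin p)) (h : Fin p → Fin p → ℤ → ℝ)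
    (e x : ℤ → Ω → Fin p → ℝ) (hx : DDAG.IsLDS P G h e x)
    (M C ρ : ℝ) (hM : DDAG.PSDMBound P x M) (hR : DDAG.AutocorrDecay P x C ρ)
    (y : Fin n → Ω' → Fin N → Fin p → ℝ)
    (hy : DDAG.RestartAndRecord P x P' y ∨ DDAG.ContinuousSampling P x P' y)
    (ε ε₁ ε₂ : ℝ) (hε₁ : 0 < ε₁) (hε₂ : 0 < ε₂) (hε : ε₂ = ε - ε₁) (hε₂M : ε₂ ≤ 12 * M)
    (hN : 2 * C * ρ⁻¹ / ((1 - ρ⁻¹) ^ 2 * ε₁) < (N : ℝ)) :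
    ∀ θ ∈ Set.Icc 0 (2 * Real.pi),
      P'.real {ω' | ε ≤ ‖DDAG.psdm P x θ - DDAG.psdmEstimator (fun r => y r ω') θ‖}
        ≤ Real.exp (-(ε₂ ^ 2 * n / (128 * M ^ 2)) + 6 * p) := by
  obtain rfl : ε = ε₁ + ε₂ := by linarith
  exact fun θ _ => corollary4p3_general hx.isStationaryGaussian
    (fun θ' hθ' μ hμ => (hM.2 θ' hθ' μ hμ).2) hR hy hε₁ hε₂ hε₂M hN θ
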